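/- **Proposition 4 (Morse triangular form).** Let $A\in\mathbb R^{n\times n}$, $B\in\mathbb R^{n\times m}$, $C\in\mathbb R^{p\times n}$, $D\in\mathbb R^{p\times m}$ and consider the control system $\Lambda=(A,B,C,D)$: $\dot x=Ax+Bu$, $y=Cx+Du$. *Invariant subspaces.* Let $\mathcal V^*$ be the largest subspace $\mathcal V\subseteq\mathbb R^n$ for which some $F\in\mathbb R^{m\times n}$ satisfies $(A+BF)\mathcal V\subseteq\mathcal V$ and $(C+DF)\mathcal V=0$, and let $\mathcal U^*$ be the largest subspace of $\mathbb R^m$ of the form $B^{-1}\mathcal V\cap\ker D$ with such a $\mathcal V$. Let $\mathcal W^*$ be the smallest subspace $\mathcal W\subseteq\mathbb R^n$ for which some $K\in\mathbb R^{n\times p}$ satisfies $(A+KC)\mathcal W+\operatorname{Im}(B+KD)=\mathcal W$, and let $\mathcal Y^*$ be the smallest subspace of $\mathbb R^p$ of the form $C\mathcal W+\operatorname{Im}D$ with such a $\mathcal W$. (These largest and smallest subspaces exist.) *Morse transformations.* For invertible matrices $T_x,T_u,T_y$ of sizes $n,m,p$ and matrices $F\in\mathbb R^{m\times n}$, $K\in\mathbb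 R^{n\times p}$, the Morse transformation $(T_x,T_u,T_y,F,K)$ takes $\Lambda$ to the system $(\tilde A,\tilde B,\tilde C,\tilde D)$ given by $$\begin{bmatrix}\tilde A&\tilde B\\ \tilde C&\tilde D\end{bmatrix}=\begin{bmatrix}T_x&T_xK\\0&T_y\end{bmatrix}\begin{bmatrix}A&B\\C&D\end{bmatrix}\begin{bmatrix}T_x^{-1}&0\\FT_x^{-1}&T_u^{-1}\end{bmatrix}.$$ Two systems related in this way are Morse equivalent. A system is *prime* if it is Morse equivalent to a system of finitely many independent chains of integrators $\dot x_1=x_2,\ \dots,\ \dot x_{\sigma-1}=x_\sigma,\ \dot x_\sigma=u$, $y=x_1$, each with its own input and its own output; a chain of length $\sigma=0$ is a direct feedthrough $y=u$. *Statement.* Let $T_s^k\in\mathbb R^{n\times n_k}$ $(k=1,2,3,4)$, $T_i^1\in\mathbb R^{m\times m_1}$, $T_i^3\in\mathbb R^{m\times m_3}$, $T_o^3\in\mathbb R^{p\times p_3}$, $T_o^4\in\mathbb R^{p\times p_4}$ be any matrices of full column rank such that $$\begin{array}{ll}\operatorname{Im}T_s^1=\mathcal V^*\cap\mathcal W^*,&(\mathcal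 V^*\cap\mathcal W^*)\oplus\operatorname{Im}T_s^2=\mathcal V^*,\\(\mathcal V^*\cap\mathcal W^*)\oplus\operatorname{Im}T_s^3=\mathcal W^*,&(\mathcal V^*+\mathcal W^*)\oplus\operatorname{Im}T_s^4=\mathbb R^n,\\ \operatorname{Im}T_i^1=\mathcal U^*,&\operatorname{Im}T_i^3\oplus\operatorname{Im}T_i^1=\mathbb R^m,\\ \operatorname{Im}T_o^3=\mathcal Y^*,&\operatorname{Im}T_o^4\oplus\operatorname{Im}T_o^3=\mathbb R^p.\end{array}$$ Then $n=n_1+n_2+n_3+n_4$, $m=m_1+m_3$, $p=p_3+p_4$, the square matrices $[T_s^1\ T_s^2\ T_s^3\ T_s^4]$, $[T_i^1\ T_i^3]$, $[T_o^3\ T_o^4]$ are invertible, and, with $T_s,T_i,T_o$ denoting their inverses, there exist $F_{MT}\in\mathbb R^{m\times n}$ and $K_{MT}\in\mathbb R^{n\times p}$ such that the Morse transformation $(T_s,T_i,T_o,F_{MT},K_{MT})$ takes $\Lambda$ to a system of the Morse triangular form $$\begin{bmatrix}\tilde A&\tilde B\\ \tilde C&\tilde D\end{bmatrix}=\left[\begin{array}{cccc|cc}\tilde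 A_1&\tilde A_1^2&\tilde A_1^3&\tilde A_1^4&\tilde B_1&\tilde B_1^2\\0&\tilde A_2&0&\tilde A_2^4&0&0\\0&0&\tilde A_3&\tilde A_3^4&0&\tilde B_3\\0&0&0&\tilde A_4&0&0\\\hline 0&0&\tilde C_3&\tilde C_3^4&0&\tilde D_3\\0&0&0&\tilde C_4&0&0\end{array}\right]$$ (blocks of sizes $n_1,n_2,n_3,n_4$ for the state, $m_1,m_3$ for the input and $p_3,p_4$ for the output), in which the pair $(\tilde A_1,\tilde B_1)$ is controllable, i.e. $\sum_{k=0}^{n_1-1}\operatorname{Im}(\tilde A_1^{\,k}\tilde B_1)=\mathbb R^{n_1}$ (here $\tilde A_1^{\,k}$ is the $k$-th power of $\tilde A_1$), the pair $(\tilde C_4,\tilde A_4)$ is observable, i.e. $\bigcap_{k=0}^{n_4-1}\ker(\tilde C_4\tilde A_4^{\,k})=0$ (with powers of $\tilde A_4$), and the 4-tuple $(\tilde A_3,\tilde B_3,\tilde C_3,\tilde D_3)$ is prime. -/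

import Mathlib

open Matrix

/-- The control system `x' = A x + B u`, `y = C x + D u`, whose state, input and output
coordinates are indexed by `n`, `m` and `p`. -/
@[ext]
structure ODECS (n m p : Type*) where
  A : Matrix n n ℝ
  B : Matrix n m ℝ
  C : Matrix p n ℝ
  D : Matrix p m ℝ

namespace ODECS

section Subspaces

variable {n m p : Type*} [Fintype n] [Fintype m]

/-- Null-output `(A, B)`-controlled invariant subspaces. -/
def IsControlledInvariant (S : ODECS n m p) (V : Submodule ℝ (n → ℝ)) : Prop :=
  ∃ F : Matrix m n ℝ,
    V.map (S.A + S.B * F).mulVecLin ≤ V ∧ V.map (S.C + S.D * F).mulVecLin = ⊥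

/-- Null-output `(A, B)`-controlled invariant input subspaces: `B⁻¹ V ∩ ker D`. -/
def IsControlledInvariantInput (S : ODECS n m p) (U : Submodule ℝ (m → ℝ)) : Prop :=
  ∃ V, S.IsControlledInvariant V ∧ U = V.comap S.B.mulVecLin ⊓ LinearMap.ker S.D.mulVecLin

/-- Unknown-input `(C, A)`-conditioned invariant subspaces. -/
def IsConditionedInvariant [Fintype p] (S : ODECS n m p) (W : Submodule ℝ (n → ℝ)) : Prop :=
  ∃ K : Matrix n p ℝ,
    W.map (S.A + K * S.C).mulVecLin ⊔ LinearMap.range (S.B + K * S.D).mulVecLin = W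

/-- Unknown-input `(C, A)`-conditioned invariant output subspaces: `C W + Im D`. -/
def IsConditionedInvariantOutput [Fintype p] (S : ODECS n m p) (Y : Submodule ℝ (p → ℝ)) : Prop :=
  ∃ W, S.IsConditionedInvariant W ∧ Y = W.map S.C.mulVecLin ⊔ LinearMap.range S.D.mulVecLin

/-- The largest null-output controlled invariant subspace; see `isGreatest_VStar`. -/
def VStar (S : ODECS n m p) : Submodule ℝ (n → ℝ) :=
  sSup {V | S.IsControlledInvariant V}

/-- The largest null-output controlled invariant input subspace; see `isGreatest_UStar`. -/
def UStar (S : ODECS n m p) : Submodule ℝ (m → ℝ) :=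
  sSup {U | S.IsControlledInvariantInput U}

/-- The smallest unknown-input conditioned invariant subspace; see `isLeast_WStar`. -/
def WStar [Fintype p] (S : ODECS n m p) : Submodule ℝ (n → ℝ) :=
  sInf {W | S.IsConditionedInvariant W}

/-- The smallest unknown-input conditioned invariant output subspace; see `isLeast_YStar`. -/
def YStar [Fintype p] (S : ODECS n m p) : Submodule ℝ (p → ℝ) :=
  sInf {Y | S.IsConditionedInvariantOutput Y}

theorem isControlledInvariant_of_forall (S : ODECS n m p) (V : Submodule ℝ (n → ℝ))
    (h : ∀ x ∈ V, ∃ u, S.A *ᵥ x + S.B *ᵥ u ∈ V ∧ S.C *ᵥ x + S.D *ᵥ u = 0) :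
    S.IsControlledInvariant V := by
  classical
  let f : V × (m → ℝ) →ₗ[ℝ] ((n → ℝ) ⧸ V) × (p → ℝ) :=
    LinearMap.prod
      (V.mkQ ∘ₗ LinearMap.coprod (S.A.mulVecLin ∘ₗ V.subtype) S.B.mulVecLin)
      (LinearMap.coprod (S.C.mulVecLin ∘ₗ V.subtype) S.D.mulVecLin)
  let g : LinearMap.ker f →ₗ[ℝ] V := LinearMap.fst ℝ V (m → ℝ) ∘ₗ (LinearMap.ker f).subtype
  have hf : ∀ (x : V) (u : m → ℝ), (x, u) ∈ LinearMap.ker f ↔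
      S.A *ᵥ x + S.B *ᵥ u ∈ V ∧ S.C *ᵥ x + S.D *ᵥ u = 0 := by
    intro x u
    rw [← Submodule.Quotient.mk_eq_zero V, LinearMap.mem_ker, Prod.ext_iff]
    rfl
  have hg : LinearMap.range g = ⊤ := by
    rw [LinearMap.range_eq_top]
    intro x
    obtain ⟨u, hu⟩ := h x x.2
    exact ⟨⟨(x, u), (hf x u).2 hu⟩, rfl⟩
  obtain ⟨r, hr⟩ := g.exists_rightInverse_of_surjective hg
  obtain ⟨F, hF⟩ := LinearMap.exists_extend
    (LinearMap.snd ℝ V (m → ℝ) ∘ₗ (LinearMap.ker f).subtype ∘ₗ r)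
  have key : ∀ x : V, S.A *ᵥ x + S.B *ᵥ F x ∈ V ∧ S.C *ᵥ x + S.D *ᵥ F x = 0 := by
    intro x
    rw [← hf]
    have h1 : F x = (r x : V × (m → ℝ)).2 := LinearMap.congr_fun hF x
    have h2 : (r x : V × (m → ℝ)).1 = x := LinearMap.congr_fun hr x
    have : ((x, F x) : V × (m → ℝ)) = r x := Prod.ext h2.symm h1
    rw [this]
    exact (r x).2
  have hm : ∀ x, LinearMap.toMatrix' F *ᵥ x = F x := fun x => LinearMap.toMatrix'_mulVec F x
  refine ⟨LinearMap.toMatrix' F, ?_, ?_⟩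
  · rintro _ ⟨x, hx, rfl⟩
    have := (key ⟨x, hx⟩).1
    simpa [Matrix.add_mulVec, ← Matrix.mulVec_mulVec, hm] using this
  · rw [eq_bot_iff]
    rintro _ ⟨x, hx, rfl⟩
    have := (key ⟨x, hx⟩).2
    simpa [Matrix.add_mulVec, ← Matrix.mulVec_mulVec, hm] using this

theorem IsControlledInvariant.forall_exists {S : ODECS n m p} {V : Submodule ℝ (n → ℝ)}
    (h : S.IsControlledInvariant V) (x : n → ℝ) (hx : x ∈ V) :
    ∃ u, S.A *ᵥ x + S.B *ᵥ u ∈ V ∧ S.C *ᵥ x + S.D *ᵥ u = 0 := by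
  obtain ⟨F, h1, h2⟩ := h
  refine ⟨F *ᵥ x, ?_, ?_⟩
  · have := h1 ⟨x, hx, rfl⟩
    simpa [Matrix.add_mulVec, ← Matrix.mulVec_mulVec] using this
  · have := h2.le ⟨x, hx, rfl⟩
    simpa [Matrix.add_mulVec, ← Matrix.mulVec_mulVec] using this

theorem isGreatest_VStar (S : ODECS n m p) :
    IsGreatest {V | S.IsControlledInvariant V} S.VStar := by
  refine ⟨S.isControlledInvariant_of_forall _ ?_, fun V hV => le_sSup hV⟩
  intro x hx
  unfold VStar at hx
  rw [sSup_eq_iSup'] at hx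
  refine Submodule.iSup_induction _
    (motive := fun x => ∃ u, S.A *ᵥ x + S.B *ᵥ u ∈ S.VStar ∧ S.C *ᵥ x + S.D *ᵥ u = 0) hx ?_ ?_ ?_
  · rintro ⟨V, hV⟩ x hx
    obtain ⟨u, h1, h2⟩ := hV.forall_exists x hx
    exact ⟨u, le_sSup (a := V) hV h1, h2⟩
  · exact ⟨0, by simp, by simp⟩
  · rintro x y ⟨u, h1, h2⟩ ⟨v, h3, h4⟩
    refine ⟨u + v, ?_, ?_⟩
    · rw [Matrix.mulVec_add, Matrix.mulVec_add, add_add_add_comm]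
      exact add_mem h1 h3
    · rw [Matrix.mulVec_add, Matrix.mulVec_add, add_add_add_comm, h2, h4, add_zero]

theorem isGreatest_UStar (S : ODECS n m p) :
    IsGreatest {U | S.IsControlledInvariantInput U} S.UStar := by
  have h : IsGreatest {U | S.IsControlledInvariantInput U}
      (S.VStar.comap S.B.mulVecLin ⊓ LinearMap.ker S.D.mulVecLin) := by
    refine ⟨⟨_, S.isGreatest_VStar.1, rfl⟩, ?_⟩
    rintro _ ⟨V, hV, rfl⟩
    exact inf_le_inf_right _ (Submodule.comap_mono (S.isGreatest_VStar.2 hV))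
  rw [UStar, h.isLUB.sSup_eq]
  exact h

theorem IsConditionedInvariant.forall_mem [Fintype p] {S : ODECS n m p} {W : Submodule ℝ (n → ℝ)}
    (h : S.IsConditionedInvariant W) (x : n → ℝ) (hx : x ∈ W) (u : m → ℝ)
    (hy : S.C *ᵥ x + S.D *ᵥ u = 0) : S.A *ᵥ x + S.B *ᵥ u ∈ W := by
  obtain ⟨K, hK⟩ := h
  have h1 : (S.A + K * S.C) *ᵥ x + (S.B + K * S.D) *ᵥ u ∈ W :=
    hK.le (add_mem (Submodule.mem_sup_left ⟨x, hx, rfl⟩) (Submodule.mem_sup_right ⟨u, rfl⟩))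
  have h2 : (S.A + K * S.C) *ᵥ x + (S.B + K * S.D) *ᵥ u
      = S.A *ᵥ x + S.B *ᵥ u + K *ᵥ (S.C *ᵥ x + S.D *ᵥ u) := by
    simp only [Matrix.add_mulVec, Matrix.mulVec_add, Matrix.mulVec_mulVec]
    abel
  rwa [h2, hy, Matrix.mulVec_zero, add_zero] at h1

theorem isConditionedInvariant_of_forall [Fintype p] (S : ODECS n m p) (W : Submodule ℝ (n → ℝ))
    (h : ∀ x ∈ W, ∀ u, S.C *ᵥ x + S.D *ᵥ u = 0 → S.A *ᵥ x + S.B *ᵥ u ∈ W)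
    (h' : ∀ z ∈ W, ∃ x ∈ W, ∃ u, S.C *ᵥ x + S.D *ᵥ u = 0 ∧ S.A *ᵥ x + S.B *ᵥ u = z) :
    S.IsConditionedInvariant W := by
  classical
  let L : W × (m → ℝ) →ₗ[ℝ] (p → ℝ) :=
    LinearMap.coprod (S.C.mulVecLin ∘ₗ W.subtype) S.D.mulVecLin
  let N : W × (m → ℝ) →ₗ[ℝ] (n → ℝ) ⧸ W :=
    W.mkQ ∘ₗ LinearMap.coprod (S.A.mulVecLin ∘ₗ W.subtype) S.B.mulVecLin
  have hLN : LinearMap.ker L ≤ LinearMap.ker N := by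
    rintro ⟨x, u⟩ hxu
    exact (Submodule.Quotient.mk_eq_zero W).2 (h x x.2 u hxu)
  obtain ⟨g, hg⟩ := LinearMap.exists_extend
    ((LinearMap.ker L).liftQ N hLN ∘ₗ L.quotKerEquivRange.symm.toLinearMap)
  have hg' : ∀ z, g (L z) = N z := by
    intro z
    have h1 := LinearMap.congr_fun hg (L.quotKerEquivRange (Submodule.Quotient.mk z))
    simpa using h1
  obtain ⟨s, hs⟩ := W.mkQ.exists_rightInverse_of_surjective W.range_mkQ
  let K : (p → ℝ) →ₗ[ℝ] (n → ℝ) := -(s ∘ₗ g)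
  have hm : ∀ y, LinearMap.toMatrix' K *ᵥ y = K y := fun y => LinearMap.toMatrix'_mulVec K y
  have key : ∀ (x : W) (u : m → ℝ),
      S.A *ᵥ x + S.B *ᵥ u + K (S.C *ᵥ x + S.D *ᵥ u) ∈ W := by
    intro x u
    rw [← Submodule.Quotient.mk_eq_zero W, Submodule.Quotient.mk_add]
    have h1 : W.mkQ (s (g (L (x, u)))) = g (L (x, u)) := LinearMap.congr_fun hs _
    have h2 : Submodule.Quotient.mk (K (S.C *ᵥ x + S.D *ᵥ u)) = -W.mkQ (s (g (L (x, u)))) := rfl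
    rw [h2, h1, hg']
    exact add_neg_cancel _
  have e : ∀ (x : n → ℝ) (u : m → ℝ),
      (S.A + LinearMap.toMatrix' K * S.C) *ᵥ x + (S.B + LinearMap.toMatrix' K * S.D) *ᵥ u
        = S.A *ᵥ x + S.B *ᵥ u + K (S.C *ᵥ x + S.D *ᵥ u) := by
    intro x u
    rw [← hm]
    simp only [Matrix.add_mulVec, Matrix.mulVec_add, Matrix.mulVec_mulVec]
    abel
  refine ⟨LinearMap.toMatrix' K, le_antisymm (sup_le ?_ ?_) ?_⟩
  · rintro _ ⟨x, hx, rfl⟩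
    have h1 := key ⟨x, hx⟩ 0
    rw [← e, Matrix.mulVec_zero, add_zero] at h1
    exact h1
  · rintro _ ⟨u, rfl⟩
    have h1 := key 0 u
    rw [← e, ZeroMemClass.coe_zero, Matrix.mulVec_zero, zero_add] at h1
    exact h1
  · intro z hz
    obtain ⟨x, hx, u, h0, rfl⟩ := h' z hz
    have h1 := e x u
    rw [h0, map_zero, add_zero] at h1
    rw [← h1]
    exact add_mem (Submodule.mem_sup_left ⟨x, hx, rfl⟩) (Submodule.mem_sup_right ⟨u, rfl⟩)

theorem isLeast_WStar [Fintype p] (S : ODECS n m p) :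
    IsLeast {W | S.IsConditionedInvariant W} S.WStar := by
  let φ : Submodule ℝ (n → ℝ) →o Submodule ℝ (n → ℝ) :=
    { toFun := fun W =>
        (W.prod ⊤ ⊓ LinearMap.ker (LinearMap.coprod S.C.mulVecLin S.D.mulVecLin)).map
          (LinearMap.coprod S.A.mulVecLin S.B.mulVecLin)
      monotone' := fun W W' h => Submodule.map_mono
        (inf_le_inf_right _ (Submodule.prod_mono h le_rfl)) }
  have hφ : ∀ W z, z ∈ φ W ↔
      ∃ x ∈ W, ∃ u, S.C *ᵥ x + S.D *ᵥ u = 0 ∧ S.A *ᵥ x + S.B *ᵥ u = z := by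
    intro W z
    constructor
    · rintro ⟨⟨x, u⟩, ⟨h1, h2⟩, rfl⟩
      exact ⟨x, h1.1, u, h2, rfl⟩
    · rintro ⟨x, hx, u, h2, rfl⟩
      exact ⟨⟨x, u⟩, ⟨⟨hx, trivial⟩, h2⟩, rfl⟩
  have h : IsLeast {W | S.IsConditionedInvariant W} φ.lfp := by
    constructor
    · refine S.isConditionedInvariant_of_forall _ ?_ ?_
      · intro x hx u hu
        rw [← φ.map_lfp]
        exact (hφ _ _).2 ⟨x, hx, u, hu, rfl⟩
      · intro z hz
        rw [← φ.map_lfp] at hz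
        exact (hφ _ _).1 hz
    · intro W hW
      refine φ.lfp_le ?_
      intro z hz
      obtain ⟨x, hx, u, h0, rfl⟩ := (hφ _ _).1 hz
      exact hW.forall_mem x hx u h0
  rw [WStar, h.isGLB.sInf_eq]
  exact h

theorem isLeast_YStar [Fintype p] (S : ODECS n m p) :
    IsLeast {Y | S.IsConditionedInvariantOutput Y} S.YStar := by
  have h : IsLeast {Y | S.IsConditionedInvariantOutput Y}
      (S.WStar.map S.C.mulVecLin ⊔ LinearMap.range S.D.mulVecLin) := by
    refine ⟨⟨_, S.isLeast_WStar.1, rfl⟩, ?_⟩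
    rintro _ ⟨W, hW, rfl⟩
    exact sup_le_sup_right (Submodule.map_mono (S.isLeast_WStar.2 hW)) _
  rw [YStar, h.isGLB.sInf_eq]
  exact h

end Subspaces

end ODECS

/-- A Morse transformation `(Tx, Tu, Ty, F, K)`. The coordinate changes are invertible matrices,
given together with their inverses; the new coordinates may carry other labels than the old ones
(invertibility forces the numbers of old and new coordinates to agree). -/
structure MorseTransformation (n m p n' m' p' : Type*) [Fintype n] [Fintype m] [Fintype p]
    [Fintype n'] [Fintype m'] [Fintype p'] [DecidableEq n] [DecidableEq m] [DecidableEq p]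
    [DecidableEq n'] [DecidableEq m'] [DecidableEq p'] where
  Tx : Matrix n' n ℝ
  TxInv : Matrix n n' ℝ
  Tu : Matrix m' m ℝ
  TuInv : Matrix m m' ℝ
  Ty : Matrix p' p ℝ
  TyInv : Matrix p p' ℝ
  F : Matrix m n ℝ
  K : Matrix n p ℝ
  Tx_mul_TxInv : Tx * TxInv = 1
  TxInv_mul_Tx : TxInv * Tx = 1
  Tu_mul_TuInv : Tu * TuInv = 1
  TuInv_mul_Tu : TuInv * Tu = 1
  Ty_mul_TyInv : Ty * TyInv = 1
  TyInv_mul_Ty : TyInv * Ty = 1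

namespace MorseTransformation

variable {n m p n' m' p' : Type*} [Fintype n] [Fintype m] [Fintype p]
  [Fintype n'] [Fintype m'] [Fintype p'] [DecidableEq n] [DecidableEq m] [DecidableEq p]
  [DecidableEq n'] [DecidableEq m'] [DecidableEq p']

/-- The transformed system; see `fromBlocks_apply` for the usual block matrix formula. -/
def apply (M : MorseTransformation n m p n' m' p') (S : ODECS n m p) : ODECS n' m' p' where
  A := M.Tx * (S.A + S.B * M.F + M.K * S.C + M.K * S.D * M.F) * M.TxInv
  B := M.Tx * (S.B + M.K * S.D) * M.TuInv
  C := M.Ty * (S.C + S.D * M.F) * M.TxInv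
  D := M.Ty * S.D * M.TuInv

theorem fromBlocks_apply (M : MorseTransformation n m p n' m' p') (S : ODECS n m p) :
    fromBlocks (M.apply S).A (M.apply S).B (M.apply S).C (M.apply S).D =
      fromBlocks M.Tx (M.Tx * M.K) 0 M.Ty * fromBlocks S.A S.B S.C S.D *
        fromBlocks M.TxInv 0 (M.F * M.TxInv) M.TuInv := by
  simp only [apply, fromBlocks_multiply, fromBlocks_inj]
  refine ⟨?_, ?_, ?_, ?_⟩ <;>
    simp only [Matrix.mul_add, Matrix.add_mul, Matrix.mul_assoc, Matrix.zero_mul, Matrix.mul_zero,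
      zero_add]
  all_goals abel

end MorseTransformation

/-- The reachability space `Im B + A Im B + ⋯ + A ^ (n - 1) Im B` is the whole state space. -/
def IsControllablePair {n m : Type*} [Fintype n] [DecidableEq n] [Fintype m]
    (A : Matrix n n ℝ) (B : Matrix n m ℝ) : Prop :=
  (⨆ k : Fin (Fintype.card n), LinearMap.range (A ^ (k : ℕ) * B).mulVecLin) = ⊤

/-- The unobservable space `ker C ∩ ker (C A) ∩ ⋯ ∩ ker (C A ^ (n - 1))` is zero. -/
def IsObservablePair {n p : Type*} [Fintype n] [DecidableEq n]
    (C : Matrix p n ℝ) (A : Matrix n n ℝ) : Prop :=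
  (⨅ k : Fin (Fintype.card n), LinearMap.ker (C * A ^ (k : ℕ)).mulVecLin) = ⊥

namespace ODECS

/-- Independent chains of integrators: for every `i : Fin c` the chain
`x₀' = x₁, …, x' = u` of length `σ i` with output `x₀`, and in addition `δ` chains of length zero,
that is, `δ` direct feedthroughs `y = u`. -/
def chains {c : ℕ} (σ : Fin c → ℕ) (δ : ℕ) :
    ODECS (Σ i, Fin (σ i)) (Fin c ⊕ Fin δ) (Fin c ⊕ Fin δ) where
  A := Matrix.of fun s t => if s.1 = t.1 ∧ (s.2 : ℕ) + 1 = t.2 then 1 else 0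
  B := fromCols (Matrix.of fun s i => if s.1 = i ∧ (s.2 : ℕ) + 1 = σ s.1 then 1 else 0) 0
  C := fromRows (Matrix.of fun i s => if s.1 = i ∧ (s.2 : ℕ) = 0 then 1 else 0) 0
  D := fromBlocks 0 0 0 1

/-- A prime system is one that is Morse equivalent to independent chains of integrators. -/
def IsPrime {n m p : Type*} [Fintype n] [Fintype m] [Fintype p]
    [DecidableEq n] [DecidableEq m] [DecidableEq p] (S : ODECS n m p) : Prop :=
  ∃ (c δ : ℕ) (σ : Fin c → ℕ), (∀ i, 0 < σ i) ∧
    ∃ M : MorseTransformation n m p (Σ i, Fin (σ i)) (Fin c ⊕ Fin δ) (Fin c ⊕ Fin δ),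
      M.apply S = chains σ δ

end ODECS

/-- The blocks of a system in Morse triangular form. -/
structure MTFBlocks (n₁ n₂ n₃ n₄ m₁ m₃ p₃ p₄ : Type*) where
  A₁ : Matrix n₁ n₁ ℝ
  A₁₂ : Matrix n₁ n₂ ℝ
  A₁₃ : Matrix n₁ n₃ ℝ
  A₁₄ : Matrix n₁ n₄ ℝ
  A₂ : Matrix n₂ n₂ ℝ
  A₂₄ : Matrix n₂ n₄ ℝ
  A₃ : Matrix n₃ n₃ ℝ
  A₃₄ : Matrix n₃ n₄ ℝ
  A₄ : Matrix n₄ n₄ ℝ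
  B₁ : Matrix n₁ m₁ ℝ
  B₁₂ : Matrix n₁ m₃ ℝ
  B₃ : Matrix n₃ m₃ ℝ
  C₃ : Matrix p₃ n₃ ℝ
  C₃₄ : Matrix p₃ n₄ ℝ
  C₄ : Matrix p₄ n₄ ℝ
  D₃ : Matrix p₃ m₃ ℝ

namespace MTFBlocks

variable {n₁ n₂ n₃ n₄ m₁ m₃ p₃ p₄ : Type*}

/-- The system in Morse triangular form with the given blocks. -/
def toODECS (b : MTFBlocks n₁ n₂ n₃ n₄ m₁ m₃ p₃ p₄) :
    ODECS (n₁ ⊕ n₂ ⊕ n₃ ⊕ n₄) (m₁ ⊕ m₃) (p₃ ⊕ p₄) where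
  A :=
    fromRows (fromCols b.A₁ (fromCols b.A₁₂ (fromCols b.A₁₃ b.A₁₄)))
    (fromRows (fromCols 0 (fromCols b.A₂ (fromCols 0 b.A₂₄)))
    (fromRows (fromCols 0 (fromCols 0 (fromCols b.A₃ b.A₃₄)))
    (fromCols 0 (fromCols 0 (fromCols 0 b.A₄)))))
  B :=
    fromRows (fromCols b.B₁ b.B₁₂)
    (fromRows (fromCols 0 0)
    (fromRows (fromCols 0 b.B₃)
    (fromCols 0 0)))
  C :=
    fromRows (fromCols 0 (fromCols 0 (fromCols b.C₃ b.C₃₄)))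
    (fromCols 0 (fromCols 0 (fromCols 0 b.C₄)))
  D := fromBlocks 0 b.D₃ 0 0

/-- The diagonal subsystem `(A₃, B₃, C₃, D₃)`. -/
def subsystem₃ (b : MTFBlocks n₁ n₂ n₃ n₄ m₁ m₃ p₃ p₄) : ODECS n₃ m₃ p₃ where
  A := b.A₃
  B := b.B₃
  C := b.C₃
  D := b.D₃

end MTFBlocks

/-! Choose `F` that keeps `VStar` invariant with zero output, and `K` that makes `WStar` invariant
and lets it contain the image of `B + K D`. The two choices do not interfere: on `VStar` the output
`C + D F` vanishes, so the injection `K` is not felt there, and `WStar` admits every input, so the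
feedback `F` cannot lead out of it. The starred subspaces are governed by steps `(x, u) ↦ A x + B u`
with `C x + D u = 0`. Along such steps injection is invisible and feedback only renames inputs, so
these subspaces correspond under Morse transformations. In the given bases all four become
coordinate subspaces, and the zero blocks of the triangular form express `A V ⊆ V`, `C V = 0`, `A W
+ Im B ⊆ W`, `B U ⊆ V`, `D U = 0` and `C W + Im D ⊆ Y` (`exists_eq_toODECS`).

The diagonal blocks rest on one fact: `(x₃, u₃) ↦ (A₃ x₃ + B₃ u₃, C₃ x₃ + D₃ u₃)` is bijective.
Maximality of `VStar` and the choice of `UStar` give injectivity; `WStar` and `YStar` give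
surjectivity. Moreover, block 3 has no nonzero controlled invariant subspace. The inverse map,
restricted to zero output, runs the system backwards by a map that is nilpotent, since its stable
range would be controlled invariant. Its Jordan chains, read backwards, are the chains of
integrators (`isPrime_of_bijective`).

Controllability of block 1 follows by induction along the increasing iteration that reaches `WStar`,
where injectivity forces `x₃` and `u₃` to vanish. Observability of block 4 follows along the
decreasing iteration that reaches `VStar`, where surjectivity supplies `x₃` and `u₃`. -/

section LinearAlgebra

/-! ### Chain bases of nilpotent maps, and Cayley–Hamilton criteria for controllability and
observability. -/

open Polynomial in
theorem Polynomial.exists_basis_quotient_X_pow (k : Type*) [Field k] (r : ℕ) :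
    ∃ b : Module.Basis (Fin r) k (k[X] ⧸ Submodule.span k[X] {(X : k[X]) ^ r}),
      ∀ j, (X : k[X]) • b j = if h : (j : ℕ) + 1 < r then b ⟨j + 1, h⟩ else 0 := by
  have hm : (X ^ r : k[X]).Monic := monic_X_pow _
  have hd : (AdjoinRoot.powerBasis' hm).dim = r := natDegree_X_pow (R := k) r
  let b : Module.Basis (Fin r) k (AdjoinRoot (X ^ r : k[X])) :=
    (AdjoinRoot.powerBasis' hm).basis.reindex (finCongr hd)
  have hb : ∀ j, b j = AdjoinRoot.mk (X ^ r : k[X]) (X ^ (j : ℕ)) := by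
    intro j
    simp [b]
  let b' : Module.Basis (Fin r) k (k[X] ⧸ Submodule.span k[X] {(X : k[X]) ^ r}) := b
  have hX : ∀ j, (X : k[X]) • b' j = AdjoinRoot.mk (X ^ r : k[X]) (X ^ ((j : ℕ) + 1)) := by
    intro j
    have : b' j = Submodule.Quotient.mk (X ^ (j : ℕ)) := hb j
    rw [this, pow_succ']
    rfl
  refine ⟨b', fun j => (hX j).trans ?_⟩
  split_ifs with h
  · exact (hb ⟨j + 1, h⟩).symm
  · have : (j : ℕ) + 1 = r := by omega
    rw [this]
    exact AdjoinRoot.mk_self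

open Polynomial in
/-- A nilpotent endomorphism has a basis consisting of chains, some of which may be empty. -/
theorem LinearMap.exists_basis_chains_aux {k V : Type*} [Field k] [AddCommGroup V] [Module k V]
    [Module.Finite k V] (f : V →ₗ[k] V) (hf : IsNilpotent f) :
    ∃ (d : ℕ) (σ : Fin d → ℕ) (b : Module.Basis (Σ i, Fin (σ i)) k V),
      ∀ i (j : Fin (σ i)), f (b ⟨i, j⟩) = if h : (j : ℕ) + 1 < σ i then b ⟨i, ⟨j + 1, h⟩⟩ else 0 := by
  classical
  -- Let `X` act as `f`: nilpotency becomes `X`-power torsion, and the structure theorem over the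
  -- principal ideal domain `k[X]` splits the space into quotients by powers of `X`, each of which
  -- is one chain.
  have htors : Module.IsTorsion' (Module.AEval' f) (Submonoid.powers (X : k[X])) := by
    intro x
    obtain ⟨r, hr⟩ := hf
    refine ⟨⟨X ^ r, r, rfl⟩, ?_⟩
    change (X ^ r : k[X]) • x = 0
    apply (Module.AEval.of k V f).symm.injective
    rw [Module.AEval.of_symm_smul, aeval_X_pow, hr]
    simp
  obtain ⟨d, σ, ⟨e⟩⟩ := Module.torsion_by_prime_power_decomposition
    (R := k[X]) (p := X) irreducible_X htors
  choose bq hbq using fun i => Polynomial.exists_basis_quotient_X_pow k (σ i)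
  let bd : Module.Basis (Σ i, Fin (σ i)) k
    (DirectSum (Fin d) fun i => k[X] ⧸ Submodule.span k[X] {(X : k[X]) ^ σ i}) := DFinsupp.basis bq
  have hbd : ∀ i j, bd ⟨i, j⟩ = DirectSum.lof k[X] (Fin d)
      (fun i => k[X] ⧸ Submodule.span k[X] {(X : k[X]) ^ σ i}) i (bq i j) := by
    intro i j
    apply bd.repr.injective
    rw [Module.Basis.repr_self]
    ext ⟨i', j'⟩
    change _ = (bq i').repr (DFinsupp.single (β := fun i =>
      k[X] ⧸ Submodule.span k[X] {(X : k[X]) ^ σ i}) i (bq i j) i') j'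
    by_cases h : i = i'
    · subst h
      simp [Finsupp.single_apply]
    · rw [DFinsupp.single_eq_of_ne (Ne.symm h), Finsupp.single_eq_of_ne (by
        rintro h'; exact h (congrArg Sigma.fst h').symm)]
      simp
  have hbX : ∀ i (j : Fin (σ i)), (X : k[X]) • bd ⟨i, j⟩ =
      if h : (j : ℕ) + 1 < σ i then bd ⟨i, ⟨j + 1, h⟩⟩ else 0 := by
    intro i j
    rw [hbd, ← map_smul, hbq]
    split_ifs with h
    · rw [hbd]
    · rw [map_zero]
  have hf' : ∀ v, f ((Module.AEval.of k V f).symm (e.symm v)) =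
      (Module.AEval.of k V f).symm (e.symm ((X : k[X]) • v)) := by
    intro v
    rw [map_smul, Module.AEval.of_symm_X_smul]
    rfl
  refine ⟨d, σ, bd.map ((e.restrictScalars k).symm.trans (Module.AEval.of k V f).symm), ?_⟩
  intro i j
  refine (hf' (bd ⟨i, j⟩)).trans ?_
  rw [hbX]
  split_ifs with h
  · rfl
  · simp

/-- A nilpotent endomorphism has a basis consisting of nonempty chains. -/
theorem LinearMap.exists_basis_chains {k V : Type*} [Field k] [AddCommGroup V] [Module k V]
    [Module.Finite k V] (f : V →ₗ[k] V) (hf : IsNilpotent f) :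
    ∃ (c : ℕ) (σ : Fin c → ℕ), (∀ i, 0 < σ i) ∧
      ∃ b : Module.Basis (Σ i, Fin (σ i)) k V, ∀ i (j : Fin (σ i)),
        f (b ⟨i, j⟩) = if h : (j : ℕ) + 1 < σ i then b ⟨i, ⟨j + 1, h⟩⟩ else 0 := by
  obtain ⟨d, τ, b, hb⟩ := f.exists_basis_chains_aux hf
  -- The decomposition may contain trivial summands with exponent 0; dropping them loses no basis
  -- vector.
  let e := (Fintype.equivFin {i // 0 < τ i}).symm
  let g : (Σ i, Fin (τ (e i))) → Σ i, Fin (τ i) := fun a => ⟨e a.1, a.2⟩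
  have hg : Function.Bijective g := by
    constructor
    · rintro ⟨i, j⟩ ⟨i', j'⟩ h
      obtain ⟨h1, h2⟩ := Sigma.mk.inj_iff.1 h
      obtain rfl : i = i' := e.injective (Subtype.ext h1)
      exact congrArg _ (eq_of_heq h2)
    · rintro ⟨i, j⟩
      obtain ⟨a, ha⟩ := e.surjective ⟨i, j.pos⟩
      obtain rfl : (e a : Fin d) = i := by rw [ha]
      exact ⟨⟨a, j⟩, rfl⟩
  have hr : ∀ a, b.reindex (Equiv.ofBijective g hg).symm a = b (g a) := fun a => by simp
  refine ⟨_, fun i => τ (e i), fun i => (e i).2, b.reindex (Equiv.ofBijective g hg).symm, ?_⟩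
  intro i j
  simp only [hr]
  exact hb _ _

/-- A matrix acting bijectively on vectors is invertible. -/
theorem Matrix.exists_inverse_of_bijective {k a b : Type*} [Field k] [Fintype a] [Fintype b]
    [DecidableEq a] [DecidableEq b] (P : Matrix a b k) (h : Function.Bijective P.mulVec) :
    ∃ Q : Matrix b a k, Q * P = 1 ∧ P * Q = 1 := by
  let e := LinearEquiv.ofBijective P.mulVecLin h
  have he : ∀ x, e x = P *ᵥ x := fun x => rfl
  refine ⟨LinearMap.toMatrix' e.symm.toLinearMap, ?_, ?_⟩
  · refine Matrix.ext_of_mulVec_single fun i => ?_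
    rw [← Matrix.mulVec_mulVec, LinearMap.toMatrix'_mulVec, ← he, one_mulVec]
    exact e.symm_apply_apply _
  · refine Matrix.ext_of_mulVec_single fun i => ?_
    rw [← Matrix.mulVec_mulVec, LinearMap.toMatrix'_mulVec, ← he, one_mulVec]
    exact e.apply_symm_apply _

/-- Cayley–Hamilton: powers of a matrix are combinations of the first ones. -/
theorem Matrix.exists_pow_eq_sum {k n : Type*} [Field k] [Fintype n] [DecidableEq n]
    (A : Matrix n n k) (r : ℕ) :
    ∃ c : Fin (Fintype.card n) → k, A ^ r = ∑ i, c i • A ^ (i : ℕ) := by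
  cases isEmpty_or_nonempty n
  · exact ⟨0, Subsingleton.elim _ _⟩
  · have hdeg : (Polynomial.X ^ r %ₘ A.charpoly).natDegree < Fintype.card n := by
      rw [← A.charpoly_natDegree_eq_dim]
      refine Polynomial.natDegree_modByMonic_lt _ A.charpoly_monic fun h => ?_
      have := A.charpoly_natDegree_eq_dim
      rw [h, Polynomial.natDegree_one] at this
      exact Fintype.card_ne_zero this.symm
    refine ⟨fun i => (Polynomial.X ^ r %ₘ A.charpoly).coeff i, ?_⟩
    rw [Matrix.pow_eq_aeval_mod_charpoly, Polynomial.aeval_eq_sum_range' hdeg,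
      Finset.sum_range]

/-- By Cayley–Hamilton the truncated reachability sum is already `A`-invariant, so it is itself one
of the subspaces `R`. This removes matrix powers from the later controllability argument. -/
theorem IsControllablePair.of_forall {n m : Type*} [Fintype n] [DecidableEq n] [Fintype m]
    {A : Matrix n n ℝ} {B : Matrix n m ℝ}
    (h : ∀ R : Submodule ℝ (n → ℝ), (∀ x ∈ R, A *ᵥ x ∈ R) → (∀ u, B *ᵥ u ∈ R) → R = ⊤) :
    IsControllablePair A B := by
  have hpow : ∀ (r : ℕ) u, A ^ r *ᵥ (B *ᵥ u) ∈
      ⨆ k : Fin (Fintype.card n), LinearMap.range (A ^ (k : ℕ) * B).mulVecLin := by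
    intro r u
    obtain ⟨c, hc⟩ := A.exists_pow_eq_sum r
    rw [hc, Matrix.sum_mulVec]
    refine sum_mem fun i _ => ?_
    rw [Matrix.smul_mulVec]
    refine Submodule.smul_mem _ _ (Submodule.mem_iSup_of_mem i ⟨u, ?_⟩)
    simp
  refine h _ (fun x hx => ?_) fun u => by simpa using hpow 0 u
  refine Submodule.iSup_induction _ (motive := fun x => A *ᵥ x ∈
      ⨆ k : Fin (Fintype.card n), LinearMap.range (A ^ (k : ℕ) * B).mulVecLin) hx ?_ ?_ ?_
  · rintro i _ ⟨u, rfl⟩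
    simpa [Matrix.mulVec_mulVec, pow_succ', Matrix.mul_assoc] using hpow (i + 1) u
  · simp
  · intro x y hx hy
    rw [Matrix.mulVec_add]
    exact add_mem hx hy

/-- Dual to the controllability criterion: Cayley–Hamilton makes the truncated unobservable space an
admissible `N`. -/
theorem IsObservablePair.of_forall {n p : Type*} [Fintype n] [DecidableEq n]
    {C : Matrix p n ℝ} {A : Matrix n n ℝ}
    (h : ∀ N : Submodule ℝ (n → ℝ), (∀ x ∈ N, A *ᵥ x ∈ N) → (∀ x ∈ N, C *ᵥ x = 0) → N = ⊥) :
    IsObservablePair C A := by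
  have hpow : ∀ (r : ℕ) x,
      x ∈ (⨅ k : Fin (Fintype.card n), LinearMap.ker (C * A ^ (k : ℕ)).mulVecLin) →
      C *ᵥ (A ^ r *ᵥ x) = 0 := by
    intro r x hx
    obtain ⟨c, hc⟩ := A.exists_pow_eq_sum r
    rw [hc, Matrix.sum_mulVec, Matrix.mulVec_sum]
    refine Finset.sum_eq_zero fun i _ => ?_
    have := (Submodule.mem_iInf _).1 hx i
    rw [LinearMap.mem_ker, mulVecLin_apply, ← mulVec_mulVec] at this
    rw [Matrix.smul_mulVec, Matrix.mulVec_smul, this, smul_zero]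
  refine h _ (fun x hx => (Submodule.mem_iInf _).2 fun i => ?_) fun x hx => by simpa using hpow 0 x hx
  have := hpow (i + 1) x hx
  simpa [Matrix.mulVec_mulVec, pow_succ, Matrix.mul_assoc] using this

end LinearAlgebra

/-! ### Recognizing prime systems. -/

section Prime

variable {n m p : Type*} [Fintype n] [Fintype m] [Fintype p]

theorem Module.Basis.forall_mem_of_forall {ι k V : Type*} [Ring k] [AddCommGroup V] [Module k V]
    (b : Module.Basis ι k V) {P : Submodule k V} (h : ∀ i, b i ∈ P) (x : V) : x ∈ P := by
  have : (⊤ : Submodule k V) ≤ P := by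
    rw [← b.span_eq, Submodule.span_le]
    rintro _ ⟨i, rfl⟩
    exact h i
  exact this trivial

theorem Module.Basis.toMatrix_basisFun_mulVec_single {ι k a : Type*} [Field k] [Fintype ι]
    [DecidableEq ι] [Fintype a] (b : Module.Basis ι k (a → k)) (s : ι) :
    (Pi.basisFun k a).toMatrix b *ᵥ Pi.single s 1 = b s := by
  rw [Matrix.mulVec_single_one]
  ext t
  simp [Module.Basis.toMatrix_apply]

/-- Extension of a finite linearly independent family to a basis. -/
theorem LinearIndependent.exists_basis_sum {k V : Type*} [Field k] [AddCommGroup V] [Module k V]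
    [Module.Finite k V] {c : ℕ} {v : Fin c → V} (hv : LinearIndependent k v) :
    ∃ (δ : ℕ) (b : Module.Basis (Fin c ⊕ Fin δ) k V), ∀ i, b (.inl i) = v i := by
  obtain ⟨W, hW⟩ := exists_isCompl (Submodule.span k (Set.range v))
  exact ⟨_, ((Module.Basis.span hv).prod (Module.finBasis k W)).map
    (Submodule.prodEquivOfIsCompl _ _ hW), fun i => by simp [Module.Basis.span_apply]⟩

namespace ODECS

variable {c : ℕ} (σ : Fin c → ℕ) (δ : ℕ)

/-- The equation `xⱼ' = xⱼ₊₁` gives the rows of `A`; on basis vectors, that is by columns, `A`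
therefore lowers the index. Inputs enter at position `σ i - 1` and outputs leave at position 0. -/
theorem chains_A_mulVec_single (i : Fin c) (j : Fin (σ i)) :
    (chains σ δ).A *ᵥ Pi.single ⟨i, j⟩ 1 =
      if h : 0 < (j : ℕ) then Pi.single ⟨i, ⟨j - 1, by omega⟩⟩ 1 else 0 := by
  rw [Matrix.mulVec_single_one]
  ext ⟨i', j'⟩
  simp only [chains, Matrix.col_apply, Matrix.of_apply]
  split_ifs with h1 h2 h2
  · obtain ⟨rfl, h1⟩ := h1
    have : j' = ⟨j - 1, by omega⟩ := Fin.ext (by simp only at h1 ⊢; omega)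
    rw [this, Pi.single_eq_same]
  · omega
  · rw [Pi.single_eq_of_ne]
    intro h
    obtain ⟨rfl, h⟩ := Sigma.mk.inj_iff.1 h
    have := congrArg Fin.val (eq_of_heq h)
    simp only at this
    exact h1 ⟨rfl, by omega⟩
  · rfl

theorem chains_B_mulVec_single_inl (hσ : ∀ i, 0 < σ i) (i : Fin c) :
    (chains σ δ).B *ᵥ Pi.single (Sum.inl i) 1 =
      Pi.single ⟨i, ⟨σ i - 1, Nat.sub_lt (hσ i) one_pos⟩⟩ 1 := by
  rw [Matrix.mulVec_single_one]
  ext ⟨i', j'⟩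
  have := hσ i'
  simp only [chains, Matrix.col_apply, Matrix.of_apply, fromCols_apply_inl]
  split_ifs with h1
  · obtain ⟨rfl, h1⟩ := h1
    have : j' = ⟨σ i' - 1, Nat.sub_lt (hσ i') one_pos⟩ := Fin.ext (by simp only at h1 ⊢; omega)
    rw [this, Pi.single_eq_same]
  · rw [Pi.single_eq_of_ne]
    intro h
    obtain ⟨rfl, h⟩ := Sigma.mk.inj_iff.1 h
    have := congrArg Fin.val (eq_of_heq h)
    simp only at this
    exact h1 ⟨rfl, by omega⟩

theorem chains_B_mulVec_single_inr (d : Fin δ) :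
    (chains σ δ).B *ᵥ Pi.single (Sum.inr d) 1 = 0 := by
  rw [Matrix.mulVec_single_one]
  ext ⟨i', j'⟩
  simp [chains]

theorem chains_C_mulVec_single (i : Fin c) (j : Fin (σ i)) :
    (chains σ δ).C *ᵥ Pi.single ⟨i, j⟩ 1 =
      if (j : ℕ) = 0 then Pi.single (Sum.inl i) 1 else 0 := by
  rw [Matrix.mulVec_single_one]
  ext (i' | d)
  · by_cases hj : (j : ℕ) = 0 <;> simp [chains, hj, Pi.single_apply, eq_comm]
  · by_cases hj : (j : ℕ) = 0 <;> simp [chains, hj]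

theorem chains_D_mulVec_single_inl (i : Fin c) :
    (chains σ δ).D *ᵥ Pi.single (Sum.inl i) 1 = 0 := by
  rw [Matrix.mulVec_single_one]
  ext (i' | d) <;> simp [chains]

theorem chains_D_mulVec_single_inr (d : Fin δ) :
    (chains σ δ).D *ᵥ Pi.single (Sum.inr d) 1 = Pi.single (Sum.inr d) 1 := by
  rw [Matrix.mulVec_single_one]
  ext (i' | d')
  · simp [chains]
  · simp [chains, Matrix.one_apply, Pi.single_apply]

variable {σ δ} [DecidableEq n] [DecidableEq m] [DecidableEq p]

/-- A system is prime as soon as, after a feedback and an output injection, it acts like chains of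
integrators on suitable bases. -/
theorem isPrime_of_bases (S : ODECS n m p) (hσ : ∀ i, 0 < σ i)
    (e : Module.Basis (Σ i, Fin (σ i)) ℝ (n → ℝ)) (v : Module.Basis (Fin c ⊕ Fin δ) ℝ (m → ℝ))
    (y : Module.Basis (Fin c ⊕ Fin δ) ℝ (p → ℝ))
    (F : (n → ℝ) →ₗ[ℝ] (m → ℝ)) (K : (p → ℝ) →ₗ[ℝ] (n → ℝ))
    (hA : ∀ i j, S.A *ᵥ e ⟨i, j⟩ + S.B *ᵥ F (e ⟨i, j⟩) +
        K (S.C *ᵥ e ⟨i, j⟩ + S.D *ᵥ F (e ⟨i, j⟩)) =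
      if h : 0 < (j : ℕ) then e ⟨i, ⟨j - 1, by omega⟩⟩ else 0)
    (hB : ∀ i, S.B *ᵥ v (.inl i) + K (S.D *ᵥ v (.inl i)) =
      e ⟨i, ⟨σ i - 1, Nat.sub_lt (hσ i) one_pos⟩⟩)
    (hB' : ∀ d, S.B *ᵥ v (.inr d) + K (S.D *ᵥ v (.inr d)) = 0)
    (hC : ∀ i j, S.C *ᵥ e ⟨i, j⟩ + S.D *ᵥ F (e ⟨i, j⟩) = if (j : ℕ) = 0 then y (.inl i) else 0)
    (hD : ∀ i, S.D *ᵥ v (.inl i) = 0) (hD' : ∀ d, S.D *ᵥ v (.inr d) = y (.inr d)) :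
    S.IsPrime := by
  let M : MorseTransformation n m p (Σ i, Fin (σ i)) (Fin c ⊕ Fin δ) (Fin c ⊕ Fin δ) :=
    { Tx := e.toMatrix (Pi.basisFun ℝ n)
      TxInv := (Pi.basisFun ℝ n).toMatrix e
      Tu := v.toMatrix (Pi.basisFun ℝ m)
      TuInv := (Pi.basisFun ℝ m).toMatrix v
      Ty := y.toMatrix (Pi.basisFun ℝ p)
      TyInv := (Pi.basisFun ℝ p).toMatrix y
      F := LinearMap.toMatrix' F
      K := LinearMap.toMatrix' K
      Tx_mul_TxInv := Module.Basis.toMatrix_mul_toMatrix_flip _ _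
      TxInv_mul_Tx := Module.Basis.toMatrix_mul_toMatrix_flip _ _
      Tu_mul_TuInv := Module.Basis.toMatrix_mul_toMatrix_flip _ _
      TuInv_mul_Tu := Module.Basis.toMatrix_mul_toMatrix_flip _ _
      Ty_mul_TyInv := Module.Basis.toMatrix_mul_toMatrix_flip _ _
      TyInv_mul_Ty := Module.Basis.toMatrix_mul_toMatrix_flip _ _ }
  have hx : ∀ s, M.TxInv *ᵥ Pi.single s 1 = e s := Module.Basis.toMatrix_basisFun_mulVec_single e
  have hu : ∀ s, M.TuInv *ᵥ Pi.single s 1 = v s := Module.Basis.toMatrix_basisFun_mulVec_single v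
  have hy : ∀ s, M.TyInv *ᵥ Pi.single s 1 = y s := Module.Basis.toMatrix_basisFun_mulVec_single y
  have hF : ∀ x, M.F *ᵥ x = F x := fun x => LinearMap.toMatrix'_mulVec F x
  have hK : ∀ x, M.K *ᵥ x = K x := fun x => LinearMap.toMatrix'_mulVec K x
  have hTx : ∀ x, M.Tx *ᵥ (M.TxInv *ᵥ x) = x := fun x => by
    rw [mulVec_mulVec, M.Tx_mul_TxInv, one_mulVec]
  have hTy : ∀ x, M.Ty *ᵥ (M.TyInv *ᵥ x) = x := fun x => by
    rw [mulVec_mulVec, M.Ty_mul_TyInv, one_mulVec]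
  refine ⟨c, δ, σ, hσ, M, ?_⟩
  ext1
  · refine Matrix.ext_of_mulVec_single fun ⟨i, j⟩ => ?_
    have h := hA i j
    rw [chains_A_mulVec_single, ← hTx (dite _ _ _)]
    simp only [MorseTransformation.apply, ← mulVec_mulVec, add_mulVec, hx, hF, hK]
    rw [map_add] at h
    rw [add_assoc (_ + _), h]
    split_ifs <;> simp [hx]
  · refine Matrix.ext_of_mulVec_single fun s => ?_
    rw [← hTx ((chains σ δ).B *ᵥ _)]
    simp only [MorseTransformation.apply, ← mulVec_mulVec, add_mulVec, hu, hK]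
    rcases s with i | d
    · rw [chains_B_mulVec_single_inl σ δ hσ, hx, hB]
    · simp only [chains_B_mulVec_single_inr, hB', mulVec_zero]
  · refine Matrix.ext_of_mulVec_single fun ⟨i, j⟩ => ?_
    rw [chains_C_mulVec_single, ← hTy (ite _ _ _)]
    simp only [MorseTransformation.apply, ← mulVec_mulVec, add_mulVec, hx, hF, hC]
    split_ifs <;> simp [hy]
  · refine Matrix.ext_of_mulVec_single fun s => ?_
    rw [← hTy ((chains σ δ).D *ᵥ _)]
    simp only [MorseTransformation.apply, ← mulVec_mulVec, hu]
    rcases s with i | d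
    · simp only [chains_D_mulVec_single_inl, hD, mulVec_zero]
    · rw [chains_D_mulVec_single_inr, hy, hD']

/-- A system is prime if `(x, u) ↦ (A x + B u, C x + D u)` is bijective and no nonzero subspace is
null-output controlled invariant. -/
theorem isPrime_of_bijective (S : ODECS n m p)
    (hinj : ∀ x u, S.A *ᵥ x + S.B *ᵥ u = 0 → S.C *ᵥ x + S.D *ᵥ u = 0 → x = 0 ∧ u = 0)
    (hsurj : ∀ z y, ∃ x u, S.A *ᵥ x + S.B *ᵥ u = z ∧ S.C *ᵥ x + S.D *ᵥ u = y)
    (hV : ∀ V : Submodule ℝ (n → ℝ),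
      (∀ x ∈ V, ∃ u, S.A *ᵥ x + S.B *ᵥ u ∈ V ∧ S.C *ᵥ x + S.D *ᵥ u = 0) → V = ⊥) :
    S.IsPrime := by
  let L : (n → ℝ) × (m → ℝ) →ₗ[ℝ] (n → ℝ) × (p → ℝ) :=
    LinearMap.prod (LinearMap.coprod S.A.mulVecLin S.B.mulVecLin)
      (LinearMap.coprod S.C.mulVecLin S.D.mulVecLin)
  have hL : ∀ x u, L (x, u) = (S.A *ᵥ x + S.B *ᵥ u, S.C *ᵥ x + S.D *ᵥ u) := fun x u => rfl
  have hbij : Function.Bijective L := by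
    constructor
    · rw [injective_iff_map_eq_zero]
      rintro ⟨x, u⟩ h
      rw [hL, Prod.mk_eq_zero] at h
      obtain ⟨rfl, rfl⟩ := hinj x u h.1 h.2
      rfl
    · rintro ⟨z, y⟩
      obtain ⟨x, u, h1, h2⟩ := hsurj z y
      exact ⟨(x, u), by rw [hL, h1, h2]⟩
  let E := LinearEquiv.ofBijective L hbij
  -- One step backwards with zero output: `A' z` is the unique state, and `C' z` the unique input,
  -- that lead to `z`.
  let A' : (n → ℝ) →ₗ[ℝ] (n → ℝ) := LinearMap.fst _ _ _ ∘ₗ E.symm.toLinearMap ∘ₗ LinearMap.inl _ _ _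
  let C' : (n → ℝ) →ₗ[ℝ] (m → ℝ) := LinearMap.snd _ _ _ ∘ₗ E.symm.toLinearMap ∘ₗ LinearMap.inl _ _ _
  have hE : ∀ z, E.symm (z, 0) = (A' z, C' z) := fun z => rfl
  have hAC : ∀ z, S.A *ᵥ A' z + S.B *ᵥ C' z = z ∧ S.C *ᵥ A' z + S.D *ᵥ C' z = 0 := by
    intro z
    have h := E.apply_symm_apply (z, 0)
    rw [hE] at h
    exact Prod.mk_inj.1 h
  -- The ranges of the powers stabilize. Each point of the stable range is `A' w` with `w` again in
  -- it, and the input `C' w` leads back to `w` with zero output; so this range is controlled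
  -- invariant, hence zero.
  have hnil : IsNilpotent A' := by
    obtain ⟨r, hr⟩ := WellFoundedLT.antitone_chain_condition
      (α := Submodule ℝ (n → ℝ)) (f := fun k => LinearMap.range (A' ^ k)) (fun a b h => by
        rintro _ ⟨x, rfl⟩
        exact ⟨(A' ^ (b - a)) x, by rw [← Module.End.mul_apply, ← pow_add, Nat.add_sub_cancel' h]⟩)
    have hr' : LinearMap.range (A' ^ r) = LinearMap.range (A' ^ (r + 1)) := hr (r + 1) (Nat.le_succ r)
    refine ⟨r, LinearMap.range_eq_bot.1 (hV _ fun x hx => ?_)⟩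
    rw [hr'] at hx
    obtain ⟨z, rfl⟩ := hx
    rw [pow_succ', Module.End.mul_apply]
    exact ⟨C' ((A' ^ r) z), by rw [(hAC _).1]; exact ⟨z, rfl⟩, (hAC _).2⟩
  obtain ⟨c, σ, hσ, e, he⟩ := A'.exists_basis_chains hnil
  let l : ∀ i, Fin (σ i) := fun i => ⟨σ i - 1, Nat.sub_lt (hσ i) one_pos⟩
  have hel : ∀ i, A' (e ⟨i, l i⟩) = 0 := by
    intro i
    rw [he, dif_neg]
    simp only [l]
    omega
  -- Since `A'` kills the last vector of a chain, its preimage under the bijection is a pure input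
  -- `(0, C' e)`. Independence of the last vectors thus passes to these inputs, which will drive the
  -- chains.
  have hli : LinearIndependent ℝ fun i => C' (e ⟨i, l i⟩) := by
    refine LinearIndependent.of_comp (LinearMap.inr ℝ (n → ℝ) (m → ℝ)) ?_
    have h1 : LinearIndependent ℝ fun i => e ⟨i, l i⟩ :=
      e.linearIndependent.comp (fun i => ⟨i, l i⟩) fun i i' h => (Sigma.mk.inj_iff.1 h).1
    have h2 := h1.map' (E.symm.toLinearMap ∘ₗ LinearMap.inl ℝ (n → ℝ) (p → ℝ)) (by
      rw [LinearMap.ker_eq_bot]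
      exact E.symm.injective.comp LinearMap.inl_injective)
    have h3 : (E.symm.toLinearMap ∘ₗ LinearMap.inl ℝ (n → ℝ) (p → ℝ)) ∘ (fun i => e ⟨i, l i⟩) =
        LinearMap.inr ℝ (n → ℝ) (m → ℝ) ∘ fun i => C' (e ⟨i, l i⟩) := by
      ext1 i
      change E.symm (e ⟨i, l i⟩, 0) = (0, C' (e ⟨i, l i⟩))
      rw [hE, hel]
    rwa [h3] at h2
  obtain ⟨δ, v, hv⟩ := hli.exists_basis_sum
  -- The input that leads from `e ⟨i, j⟩` to `e ⟨i, j - 1⟩` with zero output. At `j = 0` there is no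
  -- predecessor, and the default 0 leaves the output of the chain to be `C e`.
  let F : (n → ℝ) →ₗ[ℝ] (m → ℝ) := e.constr ℝ fun s =>
    if h : 0 < (s.2 : ℕ) then C' (e ⟨s.1, ⟨s.2 - 1, by omega⟩⟩) else 0
  have hF : ∀ s, F (e s) = if h : 0 < (s.2 : ℕ) then C' (e ⟨s.1, ⟨s.2 - 1, by omega⟩⟩) else 0 :=
    fun s => e.constr_basis ℝ _ s
  have hstep : ∀ i (j : Fin (σ i)) (h : 0 < (j : ℕ)), e ⟨i, j⟩ = A' (e ⟨i, ⟨j - 1, by omega⟩⟩) := by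
    intro i j h
    rw [he, dif_pos (by simp only; omega)]
    congr 2
    exact Fin.ext (by simp only; omega)
  let y₀ : Fin c ⊕ Fin δ → (p → ℝ) :=
    Sum.elim (fun i => S.C *ᵥ e ⟨i, ⟨0, hσ i⟩⟩) fun d => S.D *ᵥ v (.inr d)
  have hD : ∀ i, S.D *ᵥ v (.inl i) = 0 := by
    intro i
    have := (hAC (e ⟨i, l i⟩)).2
    rwa [hel, mulVec_zero, zero_add, ← hv] at this
  have hC : ∀ i j, S.C *ᵥ e ⟨i, j⟩ + S.D *ᵥ F (e ⟨i, j⟩) =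
      if (j : ℕ) = 0 then y₀ (.inl i) else 0 := by
    intro i j
    rw [hF]
    simp only
    split_ifs with h1 h2 h2
    · omega
    · rw [hstep i j h1]
      exact (hAC _).2
    · rw [mulVec_zero, add_zero]
      have : j = ⟨0, hσ i⟩ := Fin.ext h2
      rw [this]
      rfl
    · omega
  have hspan : ⊤ ≤ Submodule.span ℝ (Set.range y₀) := by
    rintro y -
    obtain ⟨x, u, -, rfl⟩ := hsurj 0 y
    have h1 : ∀ x, S.C *ᵥ x + S.D *ᵥ F x ∈ Submodule.span ℝ (Set.range y₀) :=
      e.forall_mem_of_forall (P := (Submodule.span ℝ (Set.range y₀)).comap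
        (S.C.mulVecLin + S.D.mulVecLin ∘ₗ F)) (by
        rintro ⟨i, j⟩
        change S.C *ᵥ e ⟨i, j⟩ + S.D *ᵥ F (e ⟨i, j⟩) ∈ Submodule.span ℝ (Set.range y₀)
        rw [hC]
        split_ifs
        · exact Submodule.subset_span ⟨_, rfl⟩
        · exact zero_mem _)
    have h2 : ∀ u, S.D *ᵥ u ∈ Submodule.span ℝ (Set.range y₀) :=
      v.forall_mem_of_forall (P := (Submodule.span ℝ (Set.range y₀)).comap S.D.mulVecLin) (by
        rintro (i | d)
        · change S.D *ᵥ v (.inl i) ∈ Submodule.span ℝ (Set.range y₀)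
          rw [hD]
          exact zero_mem _
        · exact Submodule.subset_span ⟨.inr d, rfl⟩)
    have h3 : S.C *ᵥ x + S.D *ᵥ u = (S.C *ᵥ x + S.D *ᵥ F x) + S.D *ᵥ (u - F x) := by
      rw [mulVec_sub]
      abel
    rw [h3]
    exact add_mem (h1 _) (h2 _)
  -- Bijectivity forces as many outputs as inputs, so the spanning family `y₀` is a basis.
  have hcard : Fintype.card (Fin c ⊕ Fin δ) = Module.finrank ℝ (p → ℝ) := by
    rw [← Module.finrank_eq_card_basis v]
    have := E.finrank_eq
    rw [Module.finrank_prod, Module.finrank_prod] at this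
    omega
  let y := basisOfTopLeSpanOfCardEqFinrank y₀ hspan hcard
  have hy : ∀ s, y s = y₀ s := fun s => by rw [coe_basisOfTopLeSpanOfCardEqFinrank]
  -- The injection cancels the two unwanted state effects: that of `A` at the output end of each
  -- chain, and that of `B` on the feedthrough inputs.
  let K : (p → ℝ) →ₗ[ℝ] (n → ℝ) := y.constr ℝ
    (Sum.elim (fun i => -(S.A *ᵥ e ⟨i, ⟨0, hσ i⟩⟩)) fun d => -(S.B *ᵥ v (.inr d)))
  have hK : ∀ i, K (y₀ (.inl i)) = -(S.A *ᵥ e ⟨i, ⟨0, hσ i⟩⟩) := fun i => by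
    rw [← hy]
    exact y.constr_basis ℝ _ _
  have hK' : ∀ d, K (y₀ (.inr d)) = -(S.B *ᵥ v (.inr d)) := fun i => by
    rw [← hy]
    exact y.constr_basis ℝ _ _
  refine S.isPrime_of_bases hσ e v y F K ?_ ?_ ?_ ?_ hD ?_
  · intro i j
    rw [hC]
    split_ifs with h1 h2 h2
    · omega
    · have : j = ⟨0, hσ i⟩ := Fin.ext h1
      subst this
      rw [hK, hF, dif_neg (lt_irrefl 0), mulVec_zero]
      abel
    · rw [hF, dif_pos h2, map_zero, add_zero, hstep i j h2]
      exact (hAC _).1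
    · omega
  · intro i
    have := (hAC (e ⟨i, l i⟩)).1
    rwa [hD, map_zero, add_zero, hv, ← zero_add (S.B *ᵥ _), ← mulVec_zero S.A, ← hel i]
  · intro d
    have := hK' d
    change K (S.D *ᵥ v (.inr d)) = _ at this
    rw [this, add_neg_cancel]
  · intro i j
    rw [hC, hy]
  · intro d
    rw [hy]
    rfl

end ODECS

end Prime

/-! ### The starred subspaces as fixed points and as limits of finite iterations. -/

namespace ODECS

section Subspaces

variable {n m p : Type*} [Fintype n] [Fintype m]

theorem le_VStar_of_forall (S : ODECS n m p) (V : Submodule ℝ (n → ℝ))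
    (h : ∀ x ∈ V, ∃ u, S.A *ᵥ x + S.B *ᵥ u ∈ V ∧ S.C *ᵥ x + S.D *ᵥ u = 0) : V ≤ S.VStar :=
  S.isGreatest_VStar.2 (S.isControlledInvariant_of_forall V h)

/-- The states that can be steered into `V` with zero output. -/
def outputNullingPreimage (S : ODECS n m p) (V : Submodule ℝ (n → ℝ)) : Submodule ℝ (n → ℝ) :=
  (V.comap (LinearMap.coprod S.A.mulVecLin S.B.mulVecLin) ⊓
    LinearMap.ker (LinearMap.coprod S.C.mulVecLin S.D.mulVecLin)).map (LinearMap.fst ℝ _ _)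

theorem mem_outputNullingPreimage (S : ODECS n m p) (V : Submodule ℝ (n → ℝ)) (x : n → ℝ) :
    x ∈ S.outputNullingPreimage V ↔
      ∃ u, S.A *ᵥ x + S.B *ᵥ u ∈ V ∧ S.C *ᵥ x + S.D *ᵥ u = 0 := by
  constructor
  · rintro ⟨⟨x, u⟩, ⟨h1, h2⟩, rfl⟩
    exact ⟨u, h1, h2⟩
  · rintro ⟨u, h1, h2⟩
    exact ⟨(x, u), ⟨h1, h2⟩, rfl⟩

theorem outputNullingPreimage_mono (S : ODECS n m p) : Monotone S.outputNullingPreimage := by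
  intro V V' h x hx
  rw [mem_outputNullingPreimage] at hx ⊢
  obtain ⟨u, h1, h2⟩ := hx
  exact ⟨u, h h1, h2⟩

/-- The preimage contains `VStar`, so its points are steered into itself; it is thus controlled
invariant, and maximality gives equality. -/
theorem outputNullingPreimage_VStar (S : ODECS n m p) :
    S.outputNullingPreimage S.VStar = S.VStar := by
  have h : S.VStar ≤ S.outputNullingPreimage S.VStar := fun x hx =>
    (S.mem_outputNullingPreimage _ x).2 (S.isGreatest_VStar.1.forall_exists x hx)
  refine le_antisymm (S.le_VStar_of_forall _ fun x hx => ?_) h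
  obtain ⟨u, h1, h2⟩ := (S.mem_outputNullingPreimage _ x).1 hx
  exact ⟨u, h h1, h2⟩

theorem mem_VStar_iff (S : ODECS n m p) (x : n → ℝ) :
    x ∈ S.VStar ↔ ∃ u, S.A *ᵥ x + S.B *ᵥ u ∈ S.VStar ∧ S.C *ᵥ x + S.D *ᵥ u = 0 := by
  rw [← mem_outputNullingPreimage, outputNullingPreimage_VStar]

/-- The decreasing iteration from the whole space reaches `VStar` after finitely many steps. -/
theorem VStar_induction (S : ODECS n m p) {P : Submodule ℝ (n → ℝ) → Prop} (top : P ⊤)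
    (step : ∀ V, S.VStar ≤ V → P V → P (S.outputNullingPreimage V)) : P S.VStar := by
  let f : ℕ → Submodule ℝ (n → ℝ) := fun k => S.outputNullingPreimage^[k] ⊤
  have hs : ∀ k, f (k + 1) = S.outputNullingPreimage (f k) := fun k =>
    Function.iterate_succ_apply' _ _ _
  have hle : ∀ k, S.VStar ≤ f k := by
    intro k
    induction k with
    | zero => exact le_top
    | succ k ih =>
      rw [hs, ← outputNullingPreimage_VStar]
      exact S.outputNullingPreimage_mono ih
  have hP : ∀ k, P (f k) := by
    intro k
    induction k with
    | zero => exact top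
    | succ k ih =>
      rw [hs]
      exact step _ (hle k) ih
  obtain ⟨r, hr⟩ := WellFoundedLT.antitone_chain_condition
    (S.outputNullingPreimage_mono.antitone_iterate_of_map_le (x := ⊤) le_top)
  have hfix : f r = S.outputNullingPreimage (f r) := (hr (r + 1) r.le_succ).trans (hs r)
  -- A fixed point of the preimage operation is controlled invariant, so the stabilized term lies
  -- below `VStar`.
  have : f r = S.VStar := le_antisymm (S.le_VStar_of_forall _ fun x hx => by
    rw [hfix] at hx
    exact (S.mem_outputNullingPreimage _ x).1 hx) (hle r)
  exact this ▸ hP r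

/-- The states that can be reached from `W` with zero output. -/
def outputNullingImage (S : ODECS n m p) (W : Submodule ℝ (n → ℝ)) : Submodule ℝ (n → ℝ) :=
  (W.comap (LinearMap.fst ℝ _ _) ⊓
    LinearMap.ker (LinearMap.coprod S.C.mulVecLin S.D.mulVecLin)).map
      (LinearMap.coprod S.A.mulVecLin S.B.mulVecLin)

theorem mem_outputNullingImage (S : ODECS n m p) (W : Submodule ℝ (n → ℝ)) (z : n → ℝ) :
    z ∈ S.outputNullingImage W ↔
      ∃ x ∈ W, ∃ u, S.C *ᵥ x + S.D *ᵥ u = 0 ∧ S.A *ᵥ x + S.B *ᵥ u = z := by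
  constructor
  · rintro ⟨⟨x, u⟩, ⟨h1, h2⟩, rfl⟩
    exact ⟨x, h1, u, h2, rfl⟩
  · rintro ⟨x, hx, u, h2, rfl⟩
    exact ⟨⟨x, u⟩, ⟨hx, h2⟩, rfl⟩

theorem outputNullingImage_mono (S : ODECS n m p) : Monotone S.outputNullingImage := by
  intro W W' h z hz
  rw [mem_outputNullingImage] at hz ⊢
  obtain ⟨x, hx, hu⟩ := hz
  exact ⟨x, h hx, hu⟩

theorem mem_UStar_iff (S : ODECS n m p) (u : m → ℝ) :
    u ∈ S.UStar ↔ S.B *ᵥ u ∈ S.VStar ∧ S.D *ᵥ u = 0 := by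
  have h : IsGreatest {U | S.IsControlledInvariantInput U}
      (S.VStar.comap S.B.mulVecLin ⊓ LinearMap.ker S.D.mulVecLin) := by
    refine ⟨⟨_, S.isGreatest_VStar.1, rfl⟩, ?_⟩
    rintro _ ⟨V, hV, rfl⟩
    exact inf_le_inf_right _ (Submodule.comap_mono (S.isGreatest_VStar.2 hV))
  rw [S.isGreatest_UStar.unique h]
  rfl

variable [Fintype p]

theorem outputNullingImage_WStar_le (S : ODECS n m p) :
    S.outputNullingImage S.WStar ≤ S.WStar := by
  intro z hz
  obtain ⟨x, hx, u, h0, rfl⟩ := (S.mem_outputNullingImage _ _).1 hz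
  exact S.isLeast_WStar.1.forall_mem x hx u h0

/-- The increasing iteration from zero reaches `WStar` after finitely many steps. -/
theorem WStar_eq_iterate (S : ODECS n m p) :
    ∃ r, S.WStar = S.outputNullingImage^[r] ⊥ ∧
      S.outputNullingImage (S.outputNullingImage^[r] ⊥) = S.outputNullingImage^[r] ⊥ := by
  let f : ℕ → Submodule ℝ (n → ℝ) := fun k => S.outputNullingImage^[k] ⊥
  have hs : ∀ k, f (k + 1) = S.outputNullingImage (f k) := fun k =>
    Function.iterate_succ_apply' _ _ _
  have hle : ∀ k, f k ≤ S.WStar := by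
    intro k
    induction k with
    | zero => exact bot_le
    | succ k ih =>
      rw [hs]
      exact (S.outputNullingImage_mono ih).trans S.outputNullingImage_WStar_le
  obtain ⟨r, hr⟩ := WellFoundedGT.monotone_chain_condition
    ⟨f, S.outputNullingImage_mono.monotone_iterate_of_le_map (x := ⊥) bot_le⟩
  have hfix : S.outputNullingImage (f r) = f r := ((hr (r + 1) r.le_succ).trans (hs r)).symm
  refine ⟨r, le_antisymm (S.isLeast_WStar.2 (S.isConditionedInvariant_of_forall _ ?_ ?_)) (hle r),
    hfix⟩
  · intro x hx u hu
    change _ ∈ f r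
    rw [← hfix]
    exact (S.mem_outputNullingImage _ _).2 ⟨x, hx, u, hu, rfl⟩
  · intro z hz
    change z ∈ f r at hz
    rw [← hfix] at hz
    exact (S.mem_outputNullingImage _ _).1 hz

theorem outputNullingImage_WStar (S : ODECS n m p) :
    S.outputNullingImage S.WStar = S.WStar := by
  obtain ⟨r, h1, h2⟩ := S.WStar_eq_iterate
  rw [h1, h2]

theorem mem_WStar_iff (S : ODECS n m p) (z : n → ℝ) :
    z ∈ S.WStar ↔ ∃ x ∈ S.WStar, ∃ u, S.C *ᵥ x + S.D *ᵥ u = 0 ∧ S.A *ᵥ x + S.B *ᵥ u = z := by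
  rw [← mem_outputNullingImage, outputNullingImage_WStar]

/-- The bound `W ≤ S.WStar` is kept in the inductive step so that coordinates known to vanish on
`WStar` vanish on every iterate. -/
theorem WStar_induction (S : ODECS n m p) {P : Submodule ℝ (n → ℝ) → Prop} (bot : P ⊥)
    (step : ∀ W, W ≤ S.WStar → P W → P (S.outputNullingImage W)) : P S.WStar := by
  have key : ∀ k, S.outputNullingImage^[k] ⊥ ≤ S.WStar ∧ P (S.outputNullingImage^[k] ⊥) := by
    intro k
    induction k with
    | zero => exact ⟨bot_le, bot⟩
    | succ k ih =>
      rw [Function.iterate_succ_apply']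
      exact ⟨(S.outputNullingImage_mono ih.1).trans S.outputNullingImage_WStar_le, step _ ih.1 ih.2⟩
  obtain ⟨r, h, -⟩ := S.WStar_eq_iterate
  rw [h]
  exact (key r).2

theorem WStar_le_of_forall (S : ODECS n m p) (W : Submodule ℝ (n → ℝ))
    (h : ∀ x ∈ W, ∀ u, S.C *ᵥ x + S.D *ᵥ u = 0 → S.A *ᵥ x + S.B *ᵥ u ∈ W) : S.WStar ≤ W := by
  refine S.WStar_induction (P := fun W' => W' ≤ W) bot_le fun W' _ hW' z hz => ?_
  obtain ⟨x, hx, u, h0, rfl⟩ := (S.mem_outputNullingImage _ _).1 hz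
  exact h x (hW' hx) u h0

theorem mem_YStar_iff (S : ODECS n m p) (y : p → ℝ) :
    y ∈ S.YStar ↔ ∃ x ∈ S.WStar, ∃ u, S.C *ᵥ x + S.D *ᵥ u = y := by
  have h : IsLeast {Y | S.IsConditionedInvariantOutput Y}
      (S.WStar.map S.C.mulVecLin ⊔ LinearMap.range S.D.mulVecLin) := by
    refine ⟨⟨_, S.isLeast_WStar.1, rfl⟩, ?_⟩
    rintro _ ⟨W, hW, rfl⟩
    exact sup_le_sup_right (Submodule.map_mono (S.isLeast_WStar.2 hW)) _
  rw [S.isLeast_YStar.unique h, Submodule.mem_sup]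
  constructor
  · rintro ⟨_, ⟨x, hx, rfl⟩, _, ⟨u, rfl⟩, rfl⟩
    exact ⟨x, hx, u, rfl⟩
  · rintro ⟨x, hx, u, rfl⟩
    exact ⟨_, ⟨x, hx, rfl⟩, _, ⟨u, rfl⟩, rfl⟩

end Subspaces

end ODECS

/-! ### Behavior of the starred subspaces under Morse transformations. -/

namespace MorseTransformation

variable {n m p n' m' p' : Type*} [Fintype n] [Fintype m] [Fintype p]
  [Fintype n'] [Fintype m'] [Fintype p'] [DecidableEq n] [DecidableEq m] [DecidableEq p]
  [DecidableEq n'] [DecidableEq m'] [DecidableEq p']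
  (M : MorseTransformation n m p n' m' p') (S : ODECS n m p)

theorem Tx_mulVec_TxInv_mulVec (x : n' → ℝ) : M.Tx *ᵥ (M.TxInv *ᵥ x) = x := by
  rw [mulVec_mulVec, M.Tx_mul_TxInv, one_mulVec]

theorem TxInv_mulVec_Tx_mulVec (x : n → ℝ) : M.TxInv *ᵥ (M.Tx *ᵥ x) = x := by
  rw [mulVec_mulVec, M.TxInv_mul_Tx, one_mulVec]

theorem TuInv_mulVec_Tu_mulVec (u : m → ℝ) : M.TuInv *ᵥ (M.Tu *ᵥ u) = u := by
  rw [mulVec_mulVec, M.TuInv_mul_Tu, one_mulVec]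

theorem TyInv_mulVec_Ty_mulVec (y : p → ℝ) : M.TyInv *ᵥ (M.Ty *ᵥ y) = y := by
  rw [mulVec_mulVec, M.TyInv_mul_Ty, one_mulVec]

theorem TyInv_mulVec_injective : Function.Injective M.TyInv.mulVec :=
  Function.LeftInverse.injective (g := M.Ty.mulVec) fun y => by
    rw [mulVec_mulVec, M.Ty_mul_TyInv, one_mulVec]

/-- Seen in old coordinates, a new step is an old step with input `F x + TuInv u`, corrected by `K`
times the old output. The correction disappears exactly where it is needed, on steps with zero
output. -/
theorem TxInv_mulVec_apply (x : n' → ℝ) (u : m' → ℝ) :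
    M.TxInv *ᵥ ((M.apply S).A *ᵥ x + (M.apply S).B *ᵥ u) =
      S.A *ᵥ (M.TxInv *ᵥ x) + S.B *ᵥ (M.F *ᵥ (M.TxInv *ᵥ x) + M.TuInv *ᵥ u) +
        M.K *ᵥ (S.C *ᵥ (M.TxInv *ᵥ x) + S.D *ᵥ (M.F *ᵥ (M.TxInv *ᵥ x) + M.TuInv *ᵥ u)) := by
  simp only [apply, ← mulVec_mulVec, mulVec_add, add_mulVec, TxInv_mulVec_Tx_mulVec]
  abel

theorem TyInv_mulVec_apply (x : n' → ℝ) (u : m' → ℝ) :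
    M.TyInv *ᵥ ((M.apply S).C *ᵥ x + (M.apply S).D *ᵥ u) =
      S.C *ᵥ (M.TxInv *ᵥ x) + S.D *ᵥ (M.F *ᵥ (M.TxInv *ᵥ x) + M.TuInv *ᵥ u) := by
  simp only [apply, ← mulVec_mulVec, mulVec_add, add_mulVec, TyInv_mulVec_Ty_mulVec]
  abel

theorem apply_output_eq_zero_iff (x : n' → ℝ) (u : m' → ℝ) :
    (M.apply S).C *ᵥ x + (M.apply S).D *ᵥ u = 0 ↔
      S.C *ᵥ (M.TxInv *ᵥ x) + S.D *ᵥ (M.F *ᵥ (M.TxInv *ᵥ x) + M.TuInv *ᵥ u) = 0 := by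
  rw [← TyInv_mulVec_apply, ← mulVec_zero M.TyInv, M.TyInv_mulVec_injective.eq_iff]

/-- Every input of the old system comes from an input of the new one. -/
theorem exists_input (x : n → ℝ) (u : m → ℝ) : ∃ u', M.F *ᵥ x + M.TuInv *ᵥ u' = u :=
  ⟨M.Tu *ᵥ (u - M.F *ᵥ x), by rw [TuInv_mulVec_Tu_mulVec, add_sub_cancel]⟩

theorem mem_VStar_apply_iff (x : n' → ℝ) :
    x ∈ (M.apply S).VStar ↔ M.TxInv *ᵥ x ∈ S.VStar := by
  constructor
  · intro hx
    have h : (M.apply S).VStar.comap M.Tx.mulVecLin ≤ S.VStar := by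
      refine S.le_VStar_of_forall _ fun z hz => ?_
      obtain ⟨u, h1, h2⟩ := ((M.apply S).mem_VStar_iff _).1 hz
      have h3 := M.TxInv_mulVec_apply S (M.Tx *ᵥ z) u
      rw [mulVecLin_apply, apply_output_eq_zero_iff] at h2
      rw [h2, TxInv_mulVec_Tx_mulVec, mulVec_zero, add_zero] at h3
      rw [TxInv_mulVec_Tx_mulVec] at h2
      refine ⟨_, ?_, h2⟩
      rw [← h3, Submodule.mem_comap, mulVecLin_apply, Tx_mulVec_TxInv_mulVec]
      exact h1
    refine h ?_
    rwa [Submodule.mem_comap, mulVecLin_apply, Tx_mulVec_TxInv_mulVec]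
  · intro hx
    refine (M.apply S).le_VStar_of_forall (S.VStar.comap M.TxInv.mulVecLin) (fun z hz => ?_) hx
    obtain ⟨u, h1, h2⟩ := (S.mem_VStar_iff _).1 hz
    obtain ⟨u', rfl⟩ := M.exists_input (M.TxInv *ᵥ z) u
    refine ⟨u', ?_, (M.apply_output_eq_zero_iff S z u').2 h2⟩
    rw [Submodule.mem_comap, mulVecLin_apply, TxInv_mulVec_apply]
    rw [mulVecLin_apply] at h1 h2
    rwa [h2, mulVec_zero, add_zero]

theorem mem_WStar_apply_iff (x : n' → ℝ) :
    x ∈ (M.apply S).WStar ↔ M.TxInv *ᵥ x ∈ S.WStar := by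
  constructor
  · intro hx
    refine (M.apply S).WStar_le_of_forall (S.WStar.comap M.TxInv.mulVecLin) (fun z hz u h => ?_) hx
    rw [apply_output_eq_zero_iff] at h
    rw [Submodule.mem_comap, mulVecLin_apply, TxInv_mulVec_apply, h, mulVec_zero, add_zero]
    exact (S.mem_WStar_iff _).2 ⟨_, hz, _, h, rfl⟩
  · intro hx
    have h : S.WStar ≤ (M.apply S).WStar.comap M.Tx.mulVecLin := by
      refine S.WStar_le_of_forall _ fun z hz u h => ?_
      obtain ⟨u', rfl⟩ := M.exists_input z u
      have h1 := M.TxInv_mulVec_apply S (M.Tx *ᵥ z) u'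
      have h2 := M.apply_output_eq_zero_iff S (M.Tx *ᵥ z) u'
      rw [TxInv_mulVec_Tx_mulVec] at h1 h2
      rw [h, mulVec_zero, add_zero] at h1
      rw [← h1, Submodule.mem_comap, mulVecLin_apply, Tx_mulVec_TxInv_mulVec]
      exact ((M.apply S).mem_WStar_iff _).2 ⟨_, hz, _, h2.2 h, rfl⟩
    have := h hx
    rwa [Submodule.mem_comap, mulVecLin_apply, Tx_mulVec_TxInv_mulVec] at this

theorem mem_UStar_apply_iff (u : m' → ℝ) :
    u ∈ (M.apply S).UStar ↔ M.TuInv *ᵥ u ∈ S.UStar := by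
  have h1 := M.TxInv_mulVec_apply S 0 u
  have h2 := M.apply_output_eq_zero_iff S 0 u
  simp only [mulVec_zero, zero_add] at h1 h2
  rw [ODECS.mem_UStar_iff, ODECS.mem_UStar_iff, mem_VStar_apply_iff, h1, h2]
  refine and_congr_left fun h => ?_
  rw [h, mulVec_zero, add_zero]

theorem mem_YStar_apply_iff (y : p' → ℝ) :
    y ∈ (M.apply S).YStar ↔ M.TyInv *ᵥ y ∈ S.YStar := by
  rw [ODECS.mem_YStar_iff, ODECS.mem_YStar_iff]
  constructor
  · rintro ⟨x, hx, u, rfl⟩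
    exact ⟨_, (M.mem_WStar_apply_iff S x).1 hx, _, (M.TyInv_mulVec_apply S x u).symm⟩
  · rintro ⟨x, hx, u, h⟩
    obtain ⟨u', rfl⟩ := M.exists_input x u
    refine ⟨M.Tx *ᵥ x, (M.mem_WStar_apply_iff S _).2 ?_, u', M.TyInv_mulVec_injective ?_⟩
    · rwa [TxInv_mulVec_Tx_mulVec]
    · rw [← h, TyInv_mulVec_apply, TxInv_mulVec_Tx_mulVec]

end MorseTransformation

/-! ### Block vectors. -/

theorem Sum.elim_eq_elim_iff {α β γ : Type*} {f f' : α → γ} {g g' : β → γ} :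
    Sum.elim f g = Sum.elim f' g' ↔ f = f' ∧ g = g' := by
  constructor
  · intro h
    exact ⟨by simpa using congrArg (· ∘ Sum.inl) h, by simpa using congrArg (· ∘ Sum.inr) h⟩
  · rintro ⟨rfl, rfl⟩
    rfl

theorem Sum.exists_eq_elim {α β γ : Type*} (h : α ⊕ β → γ) : ∃ f g, h = Sum.elim f g :=
  ⟨h ∘ Sum.inl, h ∘ Sum.inr, (Sum.elim_comp_inl_inr h).symm⟩

/-- The vector with the given four blocks. -/
def blockVec {n₁ n₂ n₃ n₄ : Type*} (x₁ : n₁ → ℝ) (x₂ : n₂ → ℝ) (x₃ : n₃ → ℝ) (x₄ : n₄ → ℝ) :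
    n₁ ⊕ n₂ ⊕ n₃ ⊕ n₄ → ℝ :=
  Sum.elim x₁ (Sum.elim x₂ (Sum.elim x₃ x₄))

theorem exists_eq_blockVec {n₁ n₂ n₃ n₄ : Type*} (x : n₁ ⊕ n₂ ⊕ n₃ ⊕ n₄ → ℝ) :
    ∃ x₁ x₂ x₃ x₄, x = blockVec x₁ x₂ x₃ x₄ := by
  obtain ⟨x₁, y, rfl⟩ := Sum.exists_eq_elim x
  obtain ⟨x₂, y, rfl⟩ := Sum.exists_eq_elim y
  obtain ⟨x₃, x₄, rfl⟩ := Sum.exists_eq_elim y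
  exact ⟨x₁, x₂, x₃, x₄, rfl⟩

theorem blockVec_inj {n₁ n₂ n₃ n₄ : Type*} {x₁ y₁ : n₁ → ℝ} {x₂ y₂ : n₂ → ℝ} {x₃ y₃ : n₃ → ℝ}
    {x₄ y₄ : n₄ → ℝ} :
    blockVec x₁ x₂ x₃ x₄ = blockVec y₁ y₂ y₃ y₄ ↔ x₁ = y₁ ∧ x₂ = y₂ ∧ x₃ = y₃ ∧ x₄ = y₄ := by
  simp only [blockVec, Sum.elim_eq_elim_iff]

theorem fromCols_mulVec_blockVec {a n₁ n₂ n₃ n₄ : Type*} [Fintype n₁] [Fintype n₂] [Fintype n₃]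
    [Fintype n₄] (T₁ : Matrix a n₁ ℝ) (T₂ : Matrix a n₂ ℝ) (T₃ : Matrix a n₃ ℝ) (T₄ : Matrix a n₄ ℝ)
    (x₁ : n₁ → ℝ) (x₂ : n₂ → ℝ) (x₃ : n₃ → ℝ) (x₄ : n₄ → ℝ) :
    fromCols T₁ (fromCols T₂ (fromCols T₃ T₄)) *ᵥ blockVec x₁ x₂ x₃ x₄ =
      T₁ *ᵥ x₁ + (T₂ *ᵥ x₂ + (T₃ *ᵥ x₃ + T₄ *ᵥ x₄)) := by
  simp only [blockVec, fromCols_mulVec_sumElim]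

/-! ### Diagonal blocks of an adapted triangular form. -/

namespace MTFBlocks

variable {n₁ n₂ n₃ n₄ m₁ m₃ p₃ p₄ : Type*} [Fintype n₁] [Fintype n₂] [Fintype n₃] [Fintype n₄]
  [Fintype m₁] [Fintype m₃]

section MulVec

variable (b : MTFBlocks n₁ n₂ n₃ n₄ m₁ m₃ p₃ p₄) (x₁ : n₁ → ℝ) (x₂ : n₂ → ℝ) (x₃ : n₃ → ℝ)
  (x₄ : n₄ → ℝ) (u₁ : m₁ → ℝ) (u₃ : m₃ → ℝ)

theorem toODECS_state :
    b.toODECS.A *ᵥ blockVec x₁ x₂ x₃ x₄ + b.toODECS.B *ᵥ Sum.elim u₁ u₃ =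
      blockVec (b.A₁ *ᵥ x₁ + b.A₁₂ *ᵥ x₂ + b.A₁₃ *ᵥ x₃ + b.A₁₄ *ᵥ x₄ + b.B₁ *ᵥ u₁ + b.B₁₂ *ᵥ u₃)
        (b.A₂ *ᵥ x₂ + b.A₂₄ *ᵥ x₄) (b.A₃ *ᵥ x₃ + b.B₃ *ᵥ u₃ + b.A₃₄ *ᵥ x₄) (b.A₄ *ᵥ x₄) := by
  simp only [toODECS, blockVec, fromRows_mulVec, fromCols_mulVec_sumElim, ← Sum.elim_add_add,
    zero_mulVec, zero_add, add_zero, Sum.elim_eq_elim_iff]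
  exact ⟨by abel, trivial, by abel, trivial⟩

theorem toODECS_output :
    b.toODECS.C *ᵥ blockVec x₁ x₂ x₃ x₄ + b.toODECS.D *ᵥ Sum.elim u₁ u₃ =
      Sum.elim (b.C₃ *ᵥ x₃ + b.D₃ *ᵥ u₃ + b.C₃₄ *ᵥ x₄) (b.C₄ *ᵥ x₄) := by
  rw [toODECS, ← fromRows_fromCols_eq_fromBlocks]
  simp only [blockVec, fromRows_mulVec, fromCols_mulVec_sumElim, ← Sum.elim_add_add,
    zero_mulVec, zero_add, add_zero, Sum.elim_eq_elim_iff]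
  exact ⟨by abel, trivial⟩

end MulVec

variable [Fintype p₃] [Fintype p₄]

/-- The invariant subspaces of a system in Morse triangular form are the coordinate subspaces. -/
structure IsAdapted (b : MTFBlocks n₁ n₂ n₃ n₄ m₁ m₃ p₃ p₄) : Prop where
  mem_V : ∀ x₁ x₂ x₃ x₄, blockVec x₁ x₂ x₃ x₄ ∈ b.toODECS.VStar ↔ x₃ = 0 ∧ x₄ = 0
  mem_W : ∀ x₁ x₂ x₃ x₄, blockVec x₁ x₂ x₃ x₄ ∈ b.toODECS.WStar ↔ x₂ = 0 ∧ x₄ = 0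
  mem_U : ∀ u₁ u₃, Sum.elim u₁ u₃ ∈ b.toODECS.UStar ↔ u₃ = 0
  mem_Y : ∀ y₃ y₄, Sum.elim y₃ y₄ ∈ b.toODECS.YStar ↔ y₄ = 0

namespace IsAdapted

variable {b : MTFBlocks n₁ n₂ n₃ n₄ m₁ m₃ p₃ p₄} (h : b.IsAdapted)

include h

/-- A kernel pair steers `(0, 0, x₃, 0)` into `VStar` with zero output, which puts it in `VStar` and
forces `x₃ = 0`; then `(0, u₃)` lies in `UStar`. -/
theorem subsystem_injective (x₃ : n₃ → ℝ) (u₃ : m₃ → ℝ) (h1 : b.A₃ *ᵥ x₃ + b.B₃ *ᵥ u₃ = 0)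
    (h2 : b.C₃ *ᵥ x₃ + b.D₃ *ᵥ u₃ = 0) : x₃ = 0 ∧ u₃ = 0 := by
  have hx : x₃ = 0 := by
    refine ((h.mem_V 0 0 x₃ 0).1 ((b.toODECS.mem_VStar_iff _).2 ⟨Sum.elim 0 u₃, ?_, ?_⟩)).1
    · rw [toODECS_state, h.mem_V]
      simp [h1]
    · rw [toODECS_output, h2]
      ext (i | i) <;> simp
  subst hx
  refine ⟨rfl, (h.mem_U 0 u₃).1 ((b.toODECS.mem_UStar_iff _).2 ⟨?_, ?_⟩)⟩
  · have := toODECS_state b 0 0 0 0 0 u₃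
    have e : (blockVec 0 0 0 0 : n₁ ⊕ n₂ ⊕ n₃ ⊕ n₄ → ℝ) = 0 := by
      ext (i | i | i | i) <;> rfl
    rw [e, mulVec_zero, zero_add] at this
    rw [this, h.mem_V]
    simpa using h1
  · have := toODECS_output b 0 0 0 0 0 u₃
    have e : (blockVec 0 0 0 0 : n₁ ⊕ n₂ ⊕ n₃ ⊕ n₄ → ℝ) = 0 := by
      ext (i | i | i | i) <;> rfl
    rw [e, mulVec_zero, zero_add] at this
    rw [this, h2]
    ext (i | i) <;> simp

/-- `YStar` supplies a pair with output `y₃`. The remaining error in the state lies in `WStar`, so a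
zero-output step from `WStar` corrects it without changing the output. -/
theorem subsystem_surjective (z₃ : n₃ → ℝ) (y₃ : p₃ → ℝ) :
    ∃ x₃ u₃, b.A₃ *ᵥ x₃ + b.B₃ *ᵥ u₃ = z₃ ∧ b.C₃ *ᵥ x₃ + b.D₃ *ᵥ u₃ = y₃ := by
  obtain ⟨x, hx, u, hy⟩ := (b.toODECS.mem_YStar_iff _).1 ((h.mem_Y y₃ 0).2 rfl)
  obtain ⟨x₁, x₂, x₃, x₄, rfl⟩ := exists_eq_blockVec x
  obtain ⟨u₁, u₃, rfl⟩ := Sum.exists_eq_elim u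
  obtain ⟨rfl, rfl⟩ := (h.mem_W _ _ _ _).1 hx
  rw [toODECS_output, Sum.elim_eq_elim_iff] at hy
  obtain ⟨w, hw, v, hw0, hz⟩ := (b.toODECS.mem_WStar_iff _).1
    ((h.mem_W 0 0 (z₃ - (b.A₃ *ᵥ x₃ + b.B₃ *ᵥ u₃)) 0).2 ⟨rfl, rfl⟩)
  obtain ⟨w₁, w₂, w₃, w₄, rfl⟩ := exists_eq_blockVec w
  obtain ⟨v₁, v₃, rfl⟩ := Sum.exists_eq_elim v
  obtain ⟨rfl, rfl⟩ := (h.mem_W _ _ _ _).1 hw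
  rw [toODECS_output, ← Sum.elim_zero_zero, Sum.elim_eq_elim_iff] at hw0
  rw [toODECS_state, blockVec_inj] at hz
  have hy' := hy.1
  have hw' := hw0.1
  have hz' := hz.2.2.1
  rw [mulVec_zero, add_zero] at hy' hw' hz'
  refine ⟨x₃ + w₃, u₃ + v₃, ?_, ?_⟩
  · rw [mulVec_add, mulVec_add, add_add_add_comm, hz']
    abel
  · rw [mulVec_add, mulVec_add, add_add_add_comm, hy', hw', add_zero]

/-- Allowing arbitrary first two blocks and setting `x₄ = 0` turns `V` into a controlled invariant
subspace of the full system, where `VStar` forces `x₃ = 0`. -/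
theorem subsystem_eq_bot (V : Submodule ℝ (n₃ → ℝ))
    (hV : ∀ x ∈ V, ∃ u, b.A₃ *ᵥ x + b.B₃ *ᵥ u ∈ V ∧ b.C₃ *ᵥ x + b.D₃ *ᵥ u = 0) : V = ⊥ := by
  let π₃ : (n₁ ⊕ n₂ ⊕ n₃ ⊕ n₄ → ℝ) →ₗ[ℝ] (n₃ → ℝ) :=
    LinearMap.funLeft ℝ ℝ fun i => Sum.inr (Sum.inr (Sum.inl i))
  let π₄ : (n₁ ⊕ n₂ ⊕ n₃ ⊕ n₄ → ℝ) →ₗ[ℝ] (n₄ → ℝ) :=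
    LinearMap.funLeft ℝ ℝ fun i => Sum.inr (Sum.inr (Sum.inr i))
  have hmem : ∀ x₁ x₂ x₃ x₄, blockVec x₁ x₂ x₃ x₄ ∈ V.comap π₃ ⊓ LinearMap.ker π₄ ↔
      x₃ ∈ V ∧ x₄ = 0 := fun _ _ _ _ => Iff.rfl
  rw [eq_bot_iff]
  intro x₃ hx₃
  refine ((h.mem_V 0 0 x₃ 0).1 (b.toODECS.le_VStar_of_forall (V.comap π₃ ⊓ LinearMap.ker π₄)
    (fun x hx => ?_) ((hmem _ _ _ _).2 ⟨hx₃, rfl⟩))).1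
  obtain ⟨x₁, x₂, x₃, x₄, rfl⟩ := exists_eq_blockVec x
  obtain ⟨hx₃, rfl⟩ := (hmem _ _ _ _).1 hx
  obtain ⟨u, h1, h2⟩ := hV x₃ hx₃
  refine ⟨Sum.elim 0 u, ?_, ?_⟩
  · rw [toODECS_state, hmem]
    simpa using h1
  · rw [toODECS_output, h2]
    ext (i | i) <;> simp

theorem isPrime_subsystem [DecidableEq n₃] [DecidableEq m₃] [DecidableEq p₃] :
    b.subsystem₃.IsPrime :=
  b.subsystem₃.isPrime_of_bijective h.subsystem_injective h.subsystem_surjective h.subsystem_eq_bot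

theorem isControllablePair [DecidableEq n₁] : IsControllablePair b.A₁ b.B₁ := by
  refine IsControllablePair.of_forall fun R hA hB => ?_
  have key : ∀ x₁ x₂, blockVec x₁ x₂ 0 0 ∈ b.toODECS.WStar → x₁ ∈ R := by
    refine b.toODECS.WStar_induction
      (P := fun W => ∀ x₁ x₂, blockVec x₁ x₂ 0 0 ∈ W → x₁ ∈ R) ?_ ?_
    · intro x₁ x₂ hx
      have e : (0 : n₁ ⊕ n₂ ⊕ n₃ ⊕ n₄ → ℝ) = blockVec 0 0 0 0 := by
        ext (i | i | i | i) <;> rfl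
      rw [Submodule.mem_bot, e, blockVec_inj] at hx
      rw [hx.1]
      exact zero_mem R
    · intro W hW ih z₁ z₂ hz
      obtain ⟨x, hx, u, h0, hxz⟩ := (b.toODECS.mem_outputNullingImage _ _).1 hz
      obtain ⟨x₁, x₂, x₃, x₄, rfl⟩ := exists_eq_blockVec x
      obtain ⟨u₁, u₃, rfl⟩ := Sum.exists_eq_elim u
      obtain ⟨rfl, rfl⟩ := (h.mem_W _ _ _ _).1 (hW hx)
      rw [toODECS_output, ← Sum.elim_zero_zero, Sum.elim_eq_elim_iff] at h0
      rw [toODECS_state, blockVec_inj] at hxz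
      have h1 := h0.1
      have h2 := hxz.2.2.1
      rw [mulVec_zero, add_zero] at h1 h2
      -- The step starts in `WStar`, ends with third block 0 and has zero output, so block 3 is idle
      -- and only `A₁ x₁ + B₁ u₁` feeds the first block.
      obtain ⟨rfl, rfl⟩ := h.subsystem_injective x₃ u₃ h2 h1
      rw [← hxz.1]
      simpa using add_mem (hA x₁ (ih _ _ hx)) (hB u₁)
  rw [eq_top_iff]
  rintro x₁ -
  exact key x₁ 0 ((h.mem_W _ _ _ _).2 ⟨rfl, rfl⟩)

/-- An unobservable `x₄` lifts to each iterate: block 3 can be chosen to cancel the output and to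
hit the required third block. Hence it lifts to `VStar`, where `x₄ = 0`. -/
theorem isObservablePair [DecidableEq n₄] : IsObservablePair b.C₄ b.A₄ := by
  refine IsObservablePair.of_forall fun N hA hC => ?_
  have key : ∀ x₄ ∈ N, ∃ x₁ x₂ x₃, blockVec x₁ x₂ x₃ x₄ ∈ b.toODECS.VStar := by
    refine b.toODECS.VStar_induction
      (P := fun V => ∀ x₄ ∈ N, ∃ x₁ x₂ x₃, blockVec x₁ x₂ x₃ x₄ ∈ V) ?_ ?_
    · exact fun x₄ _ => ⟨0, 0, 0, trivial⟩
    · intro V hV ih x₄ hx₄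
      obtain ⟨z₁, z₂, z₃, hz⟩ := ih _ (hA x₄ hx₄)
      obtain ⟨x₃, u₃, h1, h2⟩ := h.subsystem_surjective (z₃ - b.A₃₄ *ᵥ x₄) (-(b.C₃₄ *ᵥ x₄))
      refine ⟨0, 0, x₃, (b.toODECS.mem_outputNullingPreimage _ _).2 ⟨Sum.elim 0 u₃, ?_, ?_⟩⟩
      · rw [toODECS_state, h1, sub_add_cancel]
        -- The first two blocks are irrelevant because the iterate contains `VStar`.
        have hmem : ∀ y₁ y₂, blockVec y₁ y₂ z₃ (b.A₄ *ᵥ x₄) ∈ V := by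
          intro y₁ y₂
          have e : blockVec y₁ y₂ z₃ (b.A₄ *ᵥ x₄) =
              blockVec (y₁ - z₁) (y₂ - z₂) 0 0 + blockVec z₁ z₂ z₃ (b.A₄ *ᵥ x₄) := by
            ext (i | i | i | i) <;> simp [blockVec]
          rw [e]
          exact add_mem (hV ((h.mem_V _ _ _ _).2 ⟨rfl, rfl⟩)) hz
        exact hmem _ _
      · rw [toODECS_output, h2, hC x₄ hx₄, neg_add_cancel, Sum.elim_zero_zero]
  rw [eq_bot_iff]
  intro x₄ hx₄
  obtain ⟨x₁, x₂, x₃, hx⟩ := key x₄ hx₄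
  exact ((h.mem_V _ _ _ _).1 hx).2

end IsAdapted

end MTFBlocks

/-! ### The zero pattern obtained from the chosen feedback and injection. -/

namespace MorseTransformation

variable {n m p n' m' p' : Type*} [Fintype n] [Fintype m] [Fintype p]
  [Fintype n'] [Fintype m'] [Fintype p'] [DecidableEq n] [DecidableEq m] [DecidableEq p]
  [DecidableEq n'] [DecidableEq m'] [DecidableEq p']
  {M : MorseTransformation n m p n' m' p'} {S : ODECS n m p}

theorem apply_A_mulVec_mem_VStar (h1 : S.VStar.map (S.A + S.B * M.F).mulVecLin ≤ S.VStar)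
    (h2 : S.VStar.map (S.C + S.D * M.F).mulVecLin = ⊥) {x : n' → ℝ} (hx : x ∈ (M.apply S).VStar) :
    (M.apply S).A *ᵥ x ∈ (M.apply S).VStar ∧ (M.apply S).C *ᵥ x = 0 := by
  rw [mem_VStar_apply_iff] at hx ⊢
  have h3 := h1 ⟨_, hx, rfl⟩
  have h4 := h2.le ⟨_, hx, rfl⟩
  have h5 := M.TxInv_mulVec_apply S x 0
  have h6 := M.apply_output_eq_zero_iff S x 0
  simp only [mulVec_zero, add_zero] at h5 h6
  simp only [mulVecLin_apply, add_mulVec, ← mulVec_mulVec, Submodule.mem_bot] at h3 h4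
  rw [h5, h6, h4, mulVec_zero, add_zero]
  exact ⟨h3, rfl⟩

theorem apply_mem_WStar (h : S.WStar.map (S.A + M.K * S.C).mulVecLin ⊔
      LinearMap.range (S.B + M.K * S.D).mulVecLin = S.WStar)
    {x : n' → ℝ} (hx : x ∈ (M.apply S).WStar) (u : m' → ℝ) :
    (M.apply S).A *ᵥ x + (M.apply S).B *ᵥ u ∈ (M.apply S).WStar := by
  rw [mem_WStar_apply_iff] at hx ⊢
  have h1 := h.le (add_mem (Submodule.mem_sup_left ⟨_, hx, rfl⟩)
    (Submodule.mem_sup_right ⟨M.F *ᵥ (M.TxInv *ᵥ x) + M.TuInv *ᵥ u, rfl⟩))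
  rw [TxInv_mulVec_apply]
  convert h1 using 1
  simp only [mulVecLin_apply, add_mulVec, ← mulVec_mulVec, mulVec_add]
  abel

end MorseTransformation

namespace ODECS

variable {n₁ n₂ n₃ n₄ m₁ m₃ p₃ p₄ : Type*} [Fintype n₁] [Fintype n₂] [Fintype n₃] [Fintype n₄]
  [Fintype m₁] [Fintype m₃] [Fintype p₃] [Fintype p₄]

/-- A system whose invariant subspaces are coordinate subspaces, on which it acts without
feedback and output injection, is in Morse triangular form. -/
theorem exists_eq_toODECS (S : ODECS (n₁ ⊕ n₂ ⊕ n₃ ⊕ n₄) (m₁ ⊕ m₃) (p₃ ⊕ p₄))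
    (hV : ∀ x₁ x₂ x₃ x₄, blockVec x₁ x₂ x₃ x₄ ∈ S.VStar ↔ x₃ = 0 ∧ x₄ = 0)
    (hW : ∀ x₁ x₂ x₃ x₄, blockVec x₁ x₂ x₃ x₄ ∈ S.WStar ↔ x₂ = 0 ∧ x₄ = 0)
    (hU : ∀ u₁ u₃, Sum.elim u₁ u₃ ∈ S.UStar ↔ u₃ = 0)
    (hY : ∀ y₃ y₄, Sum.elim y₃ y₄ ∈ S.YStar ↔ y₄ = 0)
    (hAV : ∀ x ∈ S.VStar, S.A *ᵥ x ∈ S.VStar ∧ S.C *ᵥ x = 0)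
    (hAW : ∀ x ∈ S.WStar, ∀ u, S.A *ᵥ x + S.B *ᵥ u ∈ S.WStar) :
    ∃ b : MTFBlocks n₁ n₂ n₃ n₄ m₁ m₃ p₃ p₄, S = b.toODECS ∧ b.IsAdapted := by
  classical
  have hV' : ∀ x, x ∈ S.VStar ↔ (∀ i, x (.inr (.inr (.inl i))) = 0) ∧
      ∀ i, x (.inr (.inr (.inr i))) = 0 := by
    intro x
    obtain ⟨x₁, x₂, x₃, x₄, rfl⟩ := exists_eq_blockVec x
    rw [hV, funext_iff, funext_iff]
    rfl
  have hW' : ∀ x, x ∈ S.WStar ↔ (∀ i, x (.inr (.inl i)) = 0) ∧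
      ∀ i, x (.inr (.inr (.inr i))) = 0 := by
    intro x
    obtain ⟨x₁, x₂, x₃, x₄, rfl⟩ := exists_eq_blockVec x
    rw [hW, funext_iff, funext_iff]
    rfl
  have hU' : ∀ u, u ∈ S.UStar ↔ ∀ i, u (.inr i) = 0 := by
    intro u
    obtain ⟨u₁, u₃, rfl⟩ := Sum.exists_eq_elim u
    rw [hU, funext_iff]
    rfl
  have hY' : ∀ y, y ∈ S.YStar ↔ ∀ i, y (.inr i) = 0 := by
    intro y
    obtain ⟨y₃, y₄, rfl⟩ := Sum.exists_eq_elim y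
    rw [hY, funext_iff]
    rfl
  have hA : ∀ i j, S.A i j = (S.A *ᵥ Pi.single j 1) i := by simp
  have hB : ∀ i j, S.B i j = (S.B *ᵥ Pi.single j 1) i := by simp
  have hC : ∀ i j, S.C i j = (S.C *ᵥ Pi.single j 1) i := by simp
  have hD : ∀ i j, S.D i j = (S.D *ᵥ Pi.single j 1) i := by simp
  have hAW₀ : ∀ x ∈ S.WStar, S.A *ᵥ x ∈ S.WStar := fun x hx => by simpa using hAW x hx 0
  have hBW : ∀ u, S.B *ᵥ u ∈ S.WStar := fun u => by simpa using hAW 0 (zero_mem _) u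
  have hBU : ∀ u ∈ S.UStar, S.B *ᵥ u ∈ S.VStar ∧ S.D *ᵥ u = 0 := fun u => (S.mem_UStar_iff u).1
  have hCW : ∀ x ∈ S.WStar, S.C *ᵥ x ∈ S.YStar := fun x hx =>
    (S.mem_YStar_iff _).2 ⟨x, hx, 0, by simp⟩
  have hDY : ∀ u, S.D *ᵥ u ∈ S.YStar := fun u =>
    (S.mem_YStar_iff _).2 ⟨0, zero_mem _, u, by simp⟩
  -- Each zero entry will be a coordinate of the image of one of these unit vectors, or of an
  -- arbitrary input, in a subspace where that coordinate vanishes.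
  have v₁ : ∀ j, Pi.single (.inl j) 1 ∈ S.VStar := fun j => (hV' _).2 (by simp)
  have v₂ : ∀ j, Pi.single (.inr (.inl j)) 1 ∈ S.VStar := fun j => (hV' _).2 (by simp)
  have w₁ : ∀ j, Pi.single (.inl j) 1 ∈ S.WStar := fun j => (hW' _).2 (by simp)
  have w₃ : ∀ j, Pi.single (.inr (.inr (.inl j))) 1 ∈ S.WStar := fun j => (hW' _).2 (by simp)
  have u₁ : ∀ j, Pi.single (.inl j) 1 ∈ S.UStar := fun j => (hU' _).2 (by simp)
  let b : MTFBlocks n₁ n₂ n₃ n₄ m₁ m₃ p₃ p₄ :=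
    { A₁ := of fun i j => S.A (.inl i) (.inl j)
      A₁₂ := of fun i j => S.A (.inl i) (.inr (.inl j))
      A₁₃ := of fun i j => S.A (.inl i) (.inr (.inr (.inl j)))
      A₁₄ := of fun i j => S.A (.inl i) (.inr (.inr (.inr j)))
      A₂ := of fun i j => S.A (.inr (.inl i)) (.inr (.inl j))
      A₂₄ := of fun i j => S.A (.inr (.inl i)) (.inr (.inr (.inr j)))
      A₃ := of fun i j => S.A (.inr (.inr (.inl i))) (.inr (.inr (.inl j)))
      A₃₄ := of fun i j => S.A (.inr (.inr (.inl i))) (.inr (.inr (.inr j)))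
      A₄ := of fun i j => S.A (.inr (.inr (.inr i))) (.inr (.inr (.inr j)))
      B₁ := of fun i j => S.B (.inl i) (.inl j)
      B₁₂ := of fun i j => S.B (.inl i) (.inr j)
      B₃ := of fun i j => S.B (.inr (.inr (.inl i))) (.inr j)
      C₃ := of fun i j => S.C (.inl i) (.inr (.inr (.inl j)))
      C₃₄ := of fun i j => S.C (.inl i) (.inr (.inr (.inr j)))
      C₄ := of fun i j => S.C (.inr i) (.inr (.inr (.inr j)))
      D₃ := of fun i j => S.D (.inl i) (.inr j) }
  have hb : S = b.toODECS := by
    ext i j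
    · rcases i with i | i | i | i <;> rcases j with j | j | j | j <;> try rfl
      · exact (hA _ _).trans (((hW' _).1 (hAW₀ _ (w₁ j))).1 i)
      · exact (hA _ _).trans (((hW' _).1 (hAW₀ _ (w₃ j))).1 i)
      · exact (hA _ _).trans (((hV' _).1 (hAV _ (v₁ j)).1).1 i)
      · exact (hA _ _).trans (((hV' _).1 (hAV _ (v₂ j)).1).1 i)
      · exact (hA _ _).trans (((hV' _).1 (hAV _ (v₁ j)).1).2 i)
      · exact (hA _ _).trans (((hV' _).1 (hAV _ (v₂ j)).1).2 i)
      · exact (hA _ _).trans (((hW' _).1 (hAW₀ _ (w₃ j))).2 i)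
    · rcases i with i | i | i | i <;> rcases j with j | j <;> try rfl
      · exact (hB _ _).trans (((hW' _).1 (hBW _)).1 i)
      · exact (hB _ _).trans (((hW' _).1 (hBW _)).1 i)
      · exact (hB _ _).trans (((hV' _).1 (hBU _ (u₁ j)).1).1 i)
      · exact (hB _ _).trans (((hW' _).1 (hBW _)).2 i)
      · exact (hB _ _).trans (((hW' _).1 (hBW _)).2 i)
    · rcases i with i | i <;> rcases j with j | j | j | j <;> try rfl
      · exact (hC _ _).trans (congrFun (hAV _ (v₁ j)).2 _)
      · exact (hC _ _).trans (congrFun (hAV _ (v₂ j)).2 _)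
      · exact (hC _ _).trans (congrFun (hAV _ (v₁ j)).2 _)
      · exact (hC _ _).trans (congrFun (hAV _ (v₂ j)).2 _)
      · exact (hC _ _).trans ((hY' _).1 (hCW _ (w₃ j)) i)
    · rcases i with i | i <;> rcases j with j | j <;> try rfl
      · exact (hD _ _).trans (congrFun (hBU _ (u₁ j)).2 _)
      · exact (hD _ _).trans ((hY' _).1 (hDY _) i)
      · exact (hD _ _).trans ((hY' _).1 (hDY _) i)
  refine ⟨b, hb, ?_⟩
  rw [hb] at hV hW hU hY
  exact ⟨hV, hW, hU, hY⟩

end ODECS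

/-! ### Coordinates adapted to the given direct sums. -/

section Coordinates

variable {k a a₁ a₂ : Type*} [Field k] [Fintype a₁] [Fintype a₂]

theorem Matrix.mulVec_eq_zero_iff_of_rank_eq_card {T : Matrix a a₁ k}
    (h : T.rank = Fintype.card a₁) (x : a₁ → k) : T *ᵥ x = 0 ↔ x = 0 := by
  have h1 := LinearMap.finrank_range_add_finrank_ker T.mulVecLin
  rw [← Matrix.rank, h, Module.finrank_fintype_fun_eq_card, Nat.add_eq_left,
    Submodule.finrank_eq_zero] at h1
  rw [← mulVecLin_apply, ← LinearMap.mem_ker, h1, Submodule.mem_bot]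

theorem Matrix.mulVec_mem_range (T : Matrix a a₁ k) (x : a₁ → k) :
    T *ᵥ x ∈ LinearMap.range T.mulVecLin :=
  ⟨x, rfl⟩

theorem Matrix.fromCols_mulVec_bijective {T₁ : Matrix a a₁ k} {T₂ : Matrix a a₂ k}
    (h₁ : ∀ x, T₁ *ᵥ x = 0 ↔ x = 0) (h₂ : ∀ x, T₂ *ᵥ x = 0 ↔ x = 0)
    (h : IsCompl (LinearMap.range T₂.mulVecLin) (LinearMap.range T₁.mulVecLin)) :
    Function.Bijective (fromCols T₁ T₂).mulVec := by
  constructor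
  · change Function.Injective (fromCols T₁ T₂).mulVecLin
    rw [injective_iff_map_eq_zero]
    intro x hx
    obtain ⟨x₁, x₂, rfl⟩ := Sum.exists_eq_elim x
    rw [mulVecLin_apply, fromCols_mulVec_sumElim] at hx
    have h3 : T₂ *ᵥ x₂ = 0 := Submodule.disjoint_def.1 h.disjoint _ ⟨x₂, rfl⟩
      ⟨-x₁, by rw [mulVecLin_apply, mulVec_neg, neg_eq_of_add_eq_zero_right hx]⟩
    rw [h3, add_zero, h₁] at hx
    rw [(h₂ _).1 h3, hx, Sum.elim_zero_zero]
  · intro y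
    have hy : y ∈ LinearMap.range T₂.mulVecLin ⊔ LinearMap.range T₁.mulVecLin := by
      rw [h.sup_eq_top]
      trivial
    obtain ⟨_, ⟨x₂, rfl⟩, _, ⟨x₁, rfl⟩, rfl⟩ := Submodule.mem_sup.1 hy
    exact ⟨Sum.elim x₁ x₂, by rw [fromCols_mulVec_sumElim, add_comm]; rfl⟩

theorem Matrix.fromCols_mulVec_mem_range_left_iff {T₁ : Matrix a a₁ k} {T₂ : Matrix a a₂ k}
    (h₂ : ∀ x, T₂ *ᵥ x = 0 ↔ x = 0)
    (h : IsCompl (LinearMap.range T₂.mulVecLin) (LinearMap.range T₁.mulVecLin))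
    (x₁ : a₁ → k) (x₂ : a₂ → k) :
    fromCols T₁ T₂ *ᵥ Sum.elim x₁ x₂ ∈ LinearMap.range T₁.mulVecLin ↔ x₂ = 0 := by
  rw [fromCols_mulVec_sumElim, Submodule.add_mem_iff_right _ (T₁.mulVec_mem_range x₁), ← h₂]
  exact ⟨fun hx => Submodule.disjoint_def.1 h.disjoint _ ⟨x₂, rfl⟩ hx,
    fun hx => hx ▸ zero_mem _⟩

end Coordinates

section StateCoordinates

variable {a n₁ n₂ n₃ n₄ : Type*} [Fintype n₁] [Fintype n₂] [Fintype n₃] [Fintype n₄]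
  {V W : Submodule ℝ (a → ℝ)} {T₁ : Matrix a n₁ ℝ} {T₂ : Matrix a n₂ ℝ} {T₃ : Matrix a n₃ ℝ}
  {T₄ : Matrix a n₄ ℝ}

/-- Coordinates adapted to a pair of subspaces. -/
theorem fromCols_mulVec_mem_left_iff (h₃ : ∀ x, T₃ *ᵥ x = 0 ↔ x = 0)
    (h₄ : ∀ x, T₄ *ᵥ x = 0 ↔ x = 0) (hVW : LinearMap.range T₁.mulVecLin ≤ V)
    (hV : LinearMap.range T₂.mulVecLin ≤ V) (hW : LinearMap.range T₃.mulVecLin ≤ W)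
    (hW_disj : Disjoint (V ⊓ W) (LinearMap.range T₃.mulVecLin))
    (hX : Disjoint (V ⊔ W) (LinearMap.range T₄.mulVecLin))
    (x₁ : n₁ → ℝ) (x₂ : n₂ → ℝ) (x₃ : n₃ → ℝ) (x₄ : n₄ → ℝ) :
    T₁ *ᵥ x₁ + (T₂ *ᵥ x₂ + (T₃ *ᵥ x₃ + T₄ *ᵥ x₄)) ∈ V ↔ x₃ = 0 ∧ x₄ = 0 := by
  rw [Submodule.add_mem_iff_right _ (hVW (T₁.mulVec_mem_range x₁)),
    Submodule.add_mem_iff_right _ (hV (T₂.mulVec_mem_range x₂))]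
  constructor
  · intro h
    -- Modulo `V ⊔ W` only the fourth summand survives.
    have e₄ : x₄ = 0 := by
      rw [← h₄]
      refine Submodule.disjoint_def.1 hX _ ?_ ⟨x₄, rfl⟩
      rw [← Submodule.add_mem_iff_right _ (Submodule.mem_sup_right (hW (T₃.mulVec_mem_range x₃)))]
      exact Submodule.mem_sup_left h
    subst e₄
    rw [mulVec_zero, add_zero] at h
    exact ⟨(h₃ _).1 (Submodule.disjoint_def.1 hW_disj _ ⟨h, hW ⟨x₃, rfl⟩⟩ ⟨x₃, rfl⟩), rfl⟩
  · rintro ⟨rfl, rfl⟩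
    simp

theorem fromCols_mulVec_mem_right_iff (h₂ : ∀ x, T₂ *ᵥ x = 0 ↔ x = 0)
    (h₄ : ∀ x, T₄ *ᵥ x = 0 ↔ x = 0) (hVW : LinearMap.range T₁.mulVecLin ≤ W)
    (hV : LinearMap.range T₂.mulVecLin ≤ V) (hW : LinearMap.range T₃.mulVecLin ≤ W)
    (hV_disj : Disjoint (V ⊓ W) (LinearMap.range T₂.mulVecLin))
    (hX : Disjoint (V ⊔ W) (LinearMap.range T₄.mulVecLin))
    (x₁ : n₁ → ℝ) (x₂ : n₂ → ℝ) (x₃ : n₃ → ℝ) (x₄ : n₄ → ℝ) :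
    T₁ *ᵥ x₁ + (T₂ *ᵥ x₂ + (T₃ *ᵥ x₃ + T₄ *ᵥ x₄)) ∈ W ↔ x₂ = 0 ∧ x₄ = 0 := by
  rw [add_left_comm (T₂ *ᵥ x₂)]
  exact fromCols_mulVec_mem_left_iff (V := W) (W := V) h₂ h₄ hVW hW hV (inf_comm V W ▸ hV_disj)
    (sup_comm V W ▸ hX) x₁ x₃ x₂ x₄

theorem fromCols_mulVec_bijective_of_isCompl (h₁ : ∀ x, T₁ *ᵥ x = 0 ↔ x = 0)
    (h₂ : ∀ x, T₂ *ᵥ x = 0 ↔ x = 0) (h₃ : ∀ x, T₃ *ᵥ x = 0 ↔ x = 0)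
    (h₄ : ∀ x, T₄ *ᵥ x = 0 ↔ x = 0) (hVW : LinearMap.range T₁.mulVecLin = V ⊓ W)
    (hV_disj : Disjoint (V ⊓ W) (LinearMap.range T₂.mulVecLin))
    (hV : (V ⊓ W) ⊔ LinearMap.range T₂.mulVecLin = V)
    (hW_disj : Disjoint (V ⊓ W) (LinearMap.range T₃.mulVecLin))
    (hW : (V ⊓ W) ⊔ LinearMap.range T₃.mulVecLin = W)
    (hX : IsCompl (V ⊔ W) (LinearMap.range T₄.mulVecLin)) :
    Function.Bijective (fromCols T₁ (fromCols T₂ (fromCols T₃ T₄))).mulVec := by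
  have hle₂ : LinearMap.range T₂.mulVecLin ≤ V := le_sup_right.trans hV.le
  have hle₃ : LinearMap.range T₃.mulVecLin ≤ W := le_sup_right.trans hW.le
  constructor
  · change Function.Injective (fromCols T₁ (fromCols T₂ (fromCols T₃ T₄))).mulVecLin
    rw [injective_iff_map_eq_zero]
    intro x hx
    obtain ⟨x₁, x₂, x₃, x₄, rfl⟩ := exists_eq_blockVec x
    rw [mulVecLin_apply, fromCols_mulVec_blockVec] at hx
    obtain ⟨rfl, rfl⟩ := (fromCols_mulVec_mem_left_iff h₃ h₄ (hVW.le.trans inf_le_left) hle₂ hle₃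
      hW_disj hX.disjoint x₁ x₂ x₃ x₄).1 (hx ▸ zero_mem _)
    obtain ⟨rfl, -⟩ := (fromCols_mulVec_mem_right_iff h₂ h₄ (hVW.le.trans inf_le_right) hle₂ hle₃
      hV_disj hX.disjoint x₁ x₂ 0 0).1 (hx ▸ zero_mem _)
    simp only [mulVec_zero, add_zero] at hx
    rw [(h₁ _).1 hx]
    simp only [blockVec, Sum.elim_zero_zero]
  · intro y
    have hsup : LinearMap.range T₁.mulVecLin ⊔
        (LinearMap.range T₂.mulVecLin ⊔ LinearMap.range T₃.mulVecLin) = V ⊔ W := by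
      rw [sup_sup_distrib_left, hVW, hV, hW]
    have hy : y ∈ LinearMap.range T₁.mulVecLin ⊔
        (LinearMap.range T₂.mulVecLin ⊔ LinearMap.range T₃.mulVecLin) ⊔
        LinearMap.range T₄.mulVecLin := by
      rw [hsup, hX.sup_eq_top]
      trivial
    obtain ⟨z, hz, _, ⟨x₄, rfl⟩, rfl⟩ := Submodule.mem_sup.1 hy
    obtain ⟨_, ⟨x₁, rfl⟩, w, hw, rfl⟩ := Submodule.mem_sup.1 hz
    obtain ⟨_, ⟨x₂, rfl⟩, _, ⟨x₃, rfl⟩, rfl⟩ := Submodule.mem_sup.1 hw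
    refine ⟨blockVec x₁ x₂ x₃ x₄, ?_⟩
    rw [fromCols_mulVec_blockVec]
    simp only [mulVecLin_apply, add_assoc]

end StateCoordinates

/-- The dimension identities and the invertibility of the three block matrices are contained in `M`,
whose coordinate changes carry two-sided inverses. -/
theorem proposition4 {n m p n₁ n₂ n₃ n₄ m₁ m₃ p₃ p₄ : ℕ}
    (S : ODECS (Fin n) (Fin m) (Fin p))
    (Ts₁ : Matrix (Fin n) (Fin n₁) ℝ) (Ts₂ : Matrix (Fin n) (Fin n₂) ℝ)
    (Ts₃ : Matrix (Fin n) (Fin n₃) ℝ) (Ts₄ : Matrix (Fin n) (Fin n₄) ℝ)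
    (Ti₁ : Matrix (Fin m) (Fin m₁) ℝ) (Ti₃ : Matrix (Fin m) (Fin m₃) ℝ)
    (To₃ : Matrix (Fin p) (Fin p₃) ℝ) (To₄ : Matrix (Fin p) (Fin p₄) ℝ)
    -- the matrices have full column rank
    (hTs₁ : Ts₁.rank = n₁) (hTs₂ : Ts₂.rank = n₂) (hTs₃ : Ts₃.rank = n₃) (hTs₄ : Ts₄.rank = n₄)
    (hTi₁ : Ti₁.rank = m₁) (hTi₃ : Ti₃.rank = m₃) (hTo₃ : To₃.rank = p₃) (hTo₄ : To₄.rank = p₄)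
    -- their images are adapted to the invariant subspaces
    (hV_inf_W : LinearMap.range Ts₁.mulVecLin = S.VStar ⊓ S.WStar)
    (hV_disj : Disjoint (S.VStar ⊓ S.WStar) (LinearMap.range Ts₂.mulVecLin))
    (hV : (S.VStar ⊓ S.WStar) ⊔ LinearMap.range Ts₂.mulVecLin = S.VStar)
    (hW_disj : Disjoint (S.VStar ⊓ S.WStar) (LinearMap.range Ts₃.mulVecLin))
    (hW : (S.VStar ⊓ S.WStar) ⊔ LinearMap.range Ts₃.mulVecLin = S.WStar)
    (hX : IsCompl (S.VStar ⊔ S.WStar) (LinearMap.range Ts₄.mulVecLin))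
    (hU : LinearMap.range Ti₁.mulVecLin = S.UStar)
    (hU_compl : IsCompl (LinearMap.range Ti₃.mulVecLin) (LinearMap.range Ti₁.mulVecLin))
    (hY : LinearMap.range To₃.mulVecLin = S.YStar)
    (hY_compl : IsCompl (LinearMap.range To₄.mulVecLin) (LinearMap.range To₃.mulVecLin)) :
    ∃ M : MorseTransformation (Fin n) (Fin m) (Fin p)
        (Fin n₁ ⊕ Fin n₂ ⊕ Fin n₃ ⊕ Fin n₄) (Fin m₁ ⊕ Fin m₃) (Fin p₃ ⊕ Fin p₄),
      M.TxInv = fromCols Ts₁ (fromCols Ts₂ (fromCols Ts₃ Ts₄)) ∧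
      M.TuInv = fromCols Ti₁ Ti₃ ∧
      M.TyInv = fromCols To₃ To₄ ∧
      ∃ b : MTFBlocks (Fin n₁) (Fin n₂) (Fin n₃) (Fin n₄) (Fin m₁) (Fin m₃) (Fin p₃) (Fin p₄),
        M.apply S = b.toODECS ∧
        IsControllablePair b.A₁ b.B₁ ∧
        IsObservablePair b.C₄ b.A₄ ∧
        b.subsystem₃.IsPrime := by
  have i₁ := Matrix.mulVec_eq_zero_iff_of_rank_eq_card (hTs₁.trans (Fintype.card_fin _).symm)
  have i₂ := Matrix.mulVec_eq_zero_iff_of_rank_eq_card (hTs₂.trans (Fintype.card_fin _).symm)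
  have i₃ := Matrix.mulVec_eq_zero_iff_of_rank_eq_card (hTs₃.trans (Fintype.card_fin _).symm)
  have i₄ := Matrix.mulVec_eq_zero_iff_of_rank_eq_card (hTs₄.trans (Fintype.card_fin _).symm)
  have j₁ := Matrix.mulVec_eq_zero_iff_of_rank_eq_card (hTi₁.trans (Fintype.card_fin _).symm)
  have j₃ := Matrix.mulVec_eq_zero_iff_of_rank_eq_card (hTi₃.trans (Fintype.card_fin _).symm)
  have k₃ := Matrix.mulVec_eq_zero_iff_of_rank_eq_card (hTo₃.trans (Fintype.card_fin _).symm)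
  have k₄ := Matrix.mulVec_eq_zero_iff_of_rank_eq_card (hTo₄.trans (Fintype.card_fin _).symm)
  have hle₂ : LinearMap.range Ts₂.mulVecLin ≤ S.VStar := le_sup_right.trans hV.le
  have hle₃ : LinearMap.range Ts₃.mulVecLin ≤ S.WStar := le_sup_right.trans hW.le
  have memV := fromCols_mulVec_mem_left_iff i₃ i₄ (hV_inf_W.le.trans inf_le_left) hle₂ hle₃ hW_disj
    hX.disjoint
  have memW := fromCols_mulVec_mem_right_iff i₂ i₄ (hV_inf_W.le.trans inf_le_right) hle₂ hle₃
    hV_disj hX.disjoint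
  have hs := fromCols_mulVec_bijective_of_isCompl i₁ i₂ i₃ i₄ hV_inf_W hV_disj hV hW_disj hW hX
  obtain ⟨Tx, hTx, hTx'⟩ := Matrix.exists_inverse_of_bijective _ hs
  obtain ⟨Tu, hTu, hTu'⟩ := Matrix.exists_inverse_of_bijective _
    (Matrix.fromCols_mulVec_bijective j₁ j₃ hU_compl)
  obtain ⟨Ty, hTy, hTy'⟩ := Matrix.exists_inverse_of_bijective _
    (Matrix.fromCols_mulVec_bijective k₃ k₄ hY_compl)
  -- Independent choices: `F` for `VStar` alone and `K` for `WStar` alone.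
  obtain ⟨F, hF, hF'⟩ := S.isGreatest_VStar.1
  obtain ⟨K, hK⟩ := S.isLeast_WStar.1
  obtain ⟨M, hMx, hMu, hMy, rfl, rfl⟩ : ∃ M : MorseTransformation (Fin n) (Fin m) (Fin p)
        (Fin n₁ ⊕ Fin n₂ ⊕ Fin n₃ ⊕ Fin n₄) (Fin m₁ ⊕ Fin m₃) (Fin p₃ ⊕ Fin p₄),
      M.TxInv = fromCols Ts₁ (fromCols Ts₂ (fromCols Ts₃ Ts₄)) ∧
      M.TuInv = fromCols Ti₁ Ti₃ ∧ M.TyInv = fromCols To₃ To₄ ∧ M.F = F ∧ M.K = K :=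
    ⟨⟨Tx, _, Tu, _, Ty, _, F, K, hTx, hTx', hTu, hTu', hTy, hTy'⟩, rfl, rfl, rfl, rfl, rfl⟩
  obtain ⟨b, hb, had⟩ := (M.apply S).exists_eq_toODECS
    (fun x₁ x₂ x₃ x₄ => by
      rw [M.mem_VStar_apply_iff, hMx, fromCols_mulVec_blockVec, memV])
    (fun x₁ x₂ x₃ x₄ => by
      rw [M.mem_WStar_apply_iff, hMx, fromCols_mulVec_blockVec, memW])
    (fun u₁ u₃ => by
      rw [M.mem_UStar_apply_iff, hMu, ← hU,
        Matrix.fromCols_mulVec_mem_range_left_iff j₃ hU_compl])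
    (fun y₃ y₄ => by
      rw [M.mem_YStar_apply_iff, hMy, ← hY,
        Matrix.fromCols_mulVec_mem_range_left_iff k₄ hY_compl])
    (fun x hx => MorseTransformation.apply_A_mulVec_mem_VStar hF hF' hx)
    (fun x hx u => MorseTransformation.apply_mem_WStar hK hx u)
  exact ⟨M, hMx, hMu, hMy, b, hb, had.isControllablePair, had.isObservablePair,
    had.isPrime_subsystem⟩
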